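/- **Theorem 1.** Let $(\Omega,\mathcal F,P)$ be a probability space, $m,j\in\{0,1,2,\dots\}$, $\Theta\subseteq\mathbb R^m$, and let $\{\epsilon_{i,T}(\gamma):1\le i\le T,\ T\ge 1\}$ be a triangular array of real random variables depending on $\gamma\in\Theta$. Let $h=h_T>0$ with $h\to0$ and $Th\to\infty$ as $T\to\infty$, put $K_h(u)=K(u/h)/h$ for a function $K:\mathbb R\to\mathbb R$, and $$\hat\Psi(x,\gamma)=\frac1T\sum_{i=1}^T\epsilon_{i,T}(\gamma)\,K_h(i/T-x)\Big(\frac{i/T-x}{h}\Big)^j,\qquad x\in[0,1],\ \gamma\in\Theta .$$ For $1\le i<T$ let $\alpha_{\gamma,T}(i)$ be the supremum of $|P(A\cap B)-P(A)P(B)|$ over $1\le k\le T-i$, $B\in\sigma(\epsilon_{1,T}(\gamma),\dots,\epsilon_{k,T}(\gamma))$ and $A\in\sigma(\epsilon_{k+i,T}(\gamma),\dots,\epsilon_{T,T}(\gamma))$; put $\alpha_{\gamma,T}(i)=0$ for $i\ge T$. Assume: 1. (Mixing) There are constants $A>0$ and $\beta>2$ with $\alpha_{\gamma,T}(i)\le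 A\,i^{-\beta}$ for all $i\ge1$, $T\ge1$, $\gamma\in\Theta$. 2. (Kernel) $K$ is bounded, $\int|K|^q<\infty$ for some $q>2$, and there are constants $1\le\Lambda_1,L_1<\infty$ such that $K(u)=0$ for $|u|>L_1$ and $|K(u)-K(u')|\le\Lambda_1|u-u'|$ for all $u,u'\in\mathbb R$. 3. (Parameter dependence) For all $1\le i\le T$ there is a nonnegative random function $\xi_{i,T}(\gamma)$, $\gamma\in\Theta$, such that almost surely, for all $\gamma,\gamma'\in\Theta$ with $\|\gamma'-\gamma\|\le h_T$, $$|\epsilon_{i,T}(\gamma')-\epsilon_{i,T}(\gamma)|\le\xi_{i,T}(\gamma)\,\|\gamma'-\gamma\| .$$ Moreover there are finite constants $s>2$, $\lambda\ge0$, $\bar C_1,\bar C_2>0$ such that, for every $\gamma\in\Theta$, $\sup_{T\ge1}\sup_{1\le i\le T}E|\epsilon_{i,T}(\gamma)|^s\le\bar C_1(1+\|\gamma\|^\lambda)$ and $\sup_{T\ge1}\sup_{1\le i\le T}E|\xi_{i,T}(\gamma)|^s\le\bar C_2(1+\|\gamma\|^\lambda)$. Fix $c>0$ and define $$\theta=\frac{\beta(s-2)-m(s-1)(1+2c)-2s+1}{\beta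 s+m(s-1)+1},\qquad r=\min\Big\{c,\frac{1-\theta}{2\lambda}\Big\}\ (r=c\text{ if }\lambda=0),\qquad d_T=T^r,$$ and $\Theta_T=\{\gamma\in\Theta:\|\gamma\|\le d_T\}$. Suppose that $$\beta>\frac{m(s-1)(1+2c)+2s-1}{s-2},\qquad \frac{\ln T}{T^\theta h}=o(1),$$ and that for some constant $C$, for all $T\ge1$ and $1\le i\le T$, $$E\Big(\sup_{\gamma\in\Theta_T}|\epsilon_{i,T}(\gamma)|^s\Big)\le C(1+d_T^\lambda),\qquad E\Big(\sup_{\gamma\in\Theta_T}|\xi_{i,T}(\gamma)|^s\Big)\le C(1+d_T^\lambda).$$ Then, as $T\to\infty$, $$\sup_{\gamma\in\Theta_T}\ \sup_{x\in[0,1]}\big|\hat\Psi(x,\gamma)-E\hat\Psi(x,\gamma)\big|=O_p\!\left(d_T^\lambda\sqrt{\frac{\ln T}{Th}}\right).$$ -/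

import Mathlib

open MeasureTheory Filter Topology
open scoped ENNReal

noncomputable section

namespace KernelAvg

/-- The ambient space `ℝ^m` of the parameter, with its Euclidean norm. -/
abbrev Param (m : ℕ) : Type := EuclideanSpace ℝ (Fin m)

/-- A triangular array depending on a parameter: `ε T i γ ω` is the value of the `i`-th variable of
the `T`-th row at the parameter `γ`.  Only the entries with `1 ≤ i ≤ T` are ever used. -/
abbrev ParamArray (m : ℕ) (Ω : Type*) : Type _ := ℕ → ℕ → Param m → Ω → ℝ

section Mixing

variable {Ω : Type*}

/-- The σ-algebra generated by `X i, …, X k`. -/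
abbrev rowSigma (X : ℕ → Ω → ℝ) (i k : ℕ) : MeasurableSpace Ω :=
  ⨆ l ∈ Set.Icc i k, MeasurableSpace.comap (X l) (borel ℝ)

/-- The `α`-mixing coefficient at lag `j` of the finite sequence `X 1, …, X T`: the supremum of
`|P(A ∩ B) - P(A) P(B)|` over `1 ≤ k ≤ T - j`, `B ∈ σ(X 1, …, X k)`, `A ∈ σ(X (k+j), …, X T)`,
with the conventions `1/4` at lag `0` and `0` at lags `j ≥ T`. -/
def alphaCoeff [MeasurableSpace Ω] (P : Measure Ω) (X : ℕ → Ω → ℝ) (T j : ℕ) : ℝ :=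
  if j = 0 then 1 / 4
  else if T ≤ j then 0
  else sSup {r : ℝ | ∃ k : ℕ, 1 ≤ k ∧ k + j ≤ T ∧ ∃ A B : Set Ω,
    MeasurableSet[rowSigma X 1 k] B ∧ MeasurableSet[rowSigma X (k + j) T] A ∧
      r = |P.real (A ∩ B) - P.real A * P.real B|}

/-- The set whose supremum is taken in `alphaCoeff` is bounded, so that the supremum is genuine. -/
theorem alphaCoeff_bddAbove [MeasurableSpace Ω] (P : Measure Ω) [IsProbabilityMeasure P]
    (X : ℕ → Ω → ℝ) (T j : ℕ) :
    BddAbove {r : ℝ | ∃ k : ℕ, 1 ≤ k ∧ k + j ≤ T ∧ ∃ A B : Set Ω,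
      MeasurableSet[rowSigma X 1 k] B ∧ MeasurableSet[rowSigma X (k + j) T] A ∧
        r = |P.real (A ∩ B) - P.real A * P.real B|} := by
  refine ⟨1, ?_⟩
  rintro r ⟨k, -, -, A, B, -, -, rfl⟩
  have h1 : P.real (A ∩ B) ≤ 1 := measureReal_le_one
  have h2 : P.real A ≤ 1 := measureReal_le_one
  have h3 : P.real B ≤ 1 := measureReal_le_one
  have h4 : 0 ≤ P.real (A ∩ B) := measureReal_nonneg
  have h5 : 0 ≤ P.real A := measureReal_nonneg
  have h6 : 0 ≤ P.real B := measureReal_nonneg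
  rw [abs_le]
  constructor <;> nlinarith [mul_nonneg h5 h6, mul_le_one₀ h2 h6 h3]

end Mixing

section Assumptions

variable {m : ℕ} {Ω : Type*} [MeasurableSpace Ω]

/-- Arithmetic strong mixing of the array, uniformly in the parameter `γ ∈ Θ`:
`α_{γ,T}(i) ≤ A i^{-β}` for all `i ≥ 1`, with constants `A > 0` and `β > 2` that do not depend on
`i`, `γ`, `T`. -/
def StrongMixing (P : Measure Ω) (Θ : Set (Param m)) (ε : ParamArray m Ω) (β : ℝ) : Prop :=
  2 < β ∧ ∃ A : ℝ, 0 < A ∧ ∀ γ ∈ Θ, ∀ T : ℕ, 1 ≤ T → ∀ i : ℕ, 1 ≤ i →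
    alphaCoeff P (fun l => ε T l γ) T i ≤ A * (i : ℝ) ^ (-β)

/-- The conditions on the kernel: bounded, with an integrable power of some exponent greater
than `2`, supported in `[-L, L]` and Lipschitz. -/
structure IsKernel (K : ℝ → ℝ) : Prop where
  bounded : ∃ Kbar : ℝ, ∀ u, |K u| ≤ Kbar
  integrable_pow : ∃ q : ℝ, 2 < q ∧ Integrable (fun u => |K u| ^ q)
  support : ∃ L : ℝ, 1 ≤ L ∧ ∀ u, L < |u| → K u = 0
  lipschitz : ∃ Lam : ℝ, 1 ≤ Lam ∧ ∀ u u' : ℝ, |K u - K u'| ≤ Lam * |u - u'|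

/-- The parameter dependence: `ξ T i γ` is a nonnegative random function which is, almost surely,
a Lipschitz coefficient for `γ ↦ ε T i γ` at `γ` on the scale `h T`, and the `s`-th moments
of `ε T i γ` and `ξ T i γ` are at most of order `1 + ‖γ‖^lam`. -/
structure ParamDependence (P : Measure Ω) (Θ : Set (Param m)) (ε ξ : ParamArray m Ω)
    (h : ℕ → ℝ) (s lam : ℝ) : Prop where
  nonneg : ∀ T i : ℕ, 1 ≤ i → i ≤ T → ∀ γ ∈ Θ, ∀ ω, 0 ≤ ξ T i γ ω
  measurable_coeff : ∀ T i : ℕ, 1 ≤ i → i ≤ T → ∀ γ ∈ Θ, Measurable (ξ T i γ)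
  lipschitz : ∀ T i : ℕ, 1 ≤ i → i ≤ T → ∀ᵐ ω ∂P, ∀ γ ∈ Θ, ∀ γ' ∈ Θ, ‖γ' - γ‖ ≤ h T →
    |ε T i γ' ω - ε T i γ ω| ≤ ξ T i γ ω * ‖γ' - γ‖
  moment : ∃ C₁ : ℝ, 0 < C₁ ∧ ∀ γ ∈ Θ, ∀ T i : ℕ, 1 ≤ i → i ≤ T →
    ∫⁻ ω, ENNReal.ofReal (|ε T i γ ω| ^ s) ∂P ≤ ENNReal.ofReal (C₁ * (1 + ‖γ‖ ^ lam))
  moment_coeff : ∃ C₂ : ℝ, 0 < C₂ ∧ ∀ γ ∈ Θ, ∀ T i : ℕ, 1 ≤ i → i ≤ T →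
    ∫⁻ ω, ENNReal.ofReal (|ξ T i γ ω| ^ s) ∂P ≤ ENNReal.ofReal (C₂ * (1 + ‖γ‖ ^ lam))

/-- The bound `sup_T sup_{1 ≤ i ≤ T} E (sup_{γ ∈ Θ, ‖γ‖ ≤ d T} |ζ T i γ|^s) ≤ C (1 + (d T)^lam)`
with a constant `C` that does not depend on `T`. -/
def UniformMoment (P : Measure Ω) (Θ : Set (Param m)) (ζ : ParamArray m Ω)
    (d : ℕ → ℝ) (s lam : ℝ) : Prop :=
  ∃ C : ℝ, 0 < C ∧ ∀ T i : ℕ, 1 ≤ i → i ≤ T →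
    ∫⁻ ω, (⨆ γ ∈ {γ ∈ Θ | ‖γ‖ ≤ d T}, ENNReal.ofReal (|ζ T i γ ω| ^ s)) ∂P
      ≤ ENNReal.ofReal (C * (1 + d T ^ lam))

end Assumptions

section Average

variable {m : ℕ} {Ω : Type*}

/-- The rescaled kernel `K_h(u) = K(u/h)/h`. -/
def scaledKernel (K : ℝ → ℝ) (h u : ℝ) : ℝ := K (u / h) / h

/-- The kernel average
`Ψ̂(x,γ) = T⁻¹ ∑_{i=1}^T ε_{i,T}(γ) K_h(i/T - x) ((i/T - x)/h)^j`. -/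
def kernelAverage (K : ℝ → ℝ) (h : ℕ → ℝ) (j : ℕ) (ε : ParamArray m Ω) (T : ℕ)
    (x : ℝ) (γ : Param m) (ω : Ω) : ℝ :=
  (T : ℝ)⁻¹ * ∑ i ∈ Finset.Icc 1 T,
    ε T i γ ω * scaledKernel K (h T) ((i : ℝ) / T - x) * (((i : ℝ) / T - x) / h T) ^ j

/-- `sup_{γ ∈ Θ, ‖γ‖ ≤ d} sup_{x ∈ [0,1]} |Ψ̂(x,γ) - E Ψ̂(x,γ)|`, as an extended nonnegative
number. -/
def supDeviation [MeasurableSpace Ω] (P : Measure Ω) (K : ℝ → ℝ) (h : ℕ → ℝ) (j : ℕ)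
    (Θ : Set (Param m)) (ε : ParamArray m Ω) (T : ℕ) (d : ℝ) (ω : Ω) : ℝ≥0∞ :=
  ⨆ γ ∈ {γ ∈ Θ | ‖γ‖ ≤ d}, ⨆ x ∈ Set.Icc (0 : ℝ) 1,
    ENNReal.ofReal |kernelAverage K h j ε T x γ ω - ∫ ω', kernelAverage K h j ε T x γ ω' ∂P|

/-- `X_T = O_p(a_T)` as `T → ∞`. -/
def IsBigOp [MeasurableSpace Ω] (P : Measure Ω) (X : ℕ → Ω → ℝ≥0∞) (a : ℕ → ℝ) : Prop :=
  ∀ δ : ℝ, 0 < δ → ∃ M : ℝ, 0 < M ∧ ∀ᶠ T : ℕ in atTop,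
    P {ω | ENNReal.ofReal (M * a T) < X T ω} ≤ ENNReal.ofReal δ

end Average

/-- The exponent `θ`. -/
def theta (m : ℕ) (β s c : ℝ) : ℝ :=
  (β * (s - 2) - m * (s - 1) * (1 + 2 * c) - 2 * s + 1) / (β * s + m * (s - 1) + 1)

/-- The exponent `r = min {c, (1 - θ)/(2 lam)}`, the second entry being `+∞` if `lam = 0`. -/
def rateExponent (m : ℕ) (β s c lam : ℝ) : ℝ :=
  if lam = 0 then c else min c ((1 - theta m β s c) / (2 * lam))

/-- The radius `d_T = T^r` of the parameter set `Θ_T`. -/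
def radius (m : ℕ) (β s c lam : ℝ) (T : ℕ) : ℝ := (T : ℝ) ^ rateExponent m β s c lam

end KernelAvg

end

/-!
The supremum over the parameter is reduced to a finite net `G` of `Θ_T` with mesh `a h`, where `a =
√(log T / (T h))`, and the array is truncated at the level `τ` with `τ ^ (1 - s) = a h`. Both
replacements change the kernel average, uniformly in `x`, by at most a multiple of `a` times the
sum of a constant, the moment bounds, and the row means of `|ε_i(g)|^s` and `|ξ_i(g)|^s` at the
nearby `g ∈ G`. The maxima of these means over `G` are of order `d_T^λ` by Markov's inequality.
Only maxima over finite sets occur there, so that no measurability of the suprema over `Θ_T` is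
needed (`abs_kernelAverage_sub_integral_le`, `measure_exists_sum_rpow_gt_le`).

Summation by parts, with the Lipschitz and compactly supported weights `K u * u ^ j`, then bounds
the truncated kernel sum at every `x ∈ [0, 1]` by partial sums over about `1 / h` windows of length
about `T h` (`abs_kernel_sum_le`). This removes `x` from the problem.

The maximal partial sum over a window is treated by blocks of length `q ≈ 1 / (a τ)`
(`measure_exists_sum_ge_le`). For a family of blocks `B_k` separated by gaps, the product of `exp
B_k` divided by `E[exp B_k | past]` has mean one (up to a harmless modification of the
denominator), which gives an exponential bound for each partial sum as long as the conditional
expectations are close to the unconditional ones. Their `L¹` distance is at most a constant times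
the mixing coefficient `α(q)`, by `AlphaBound.integral_abs_condExp_sub_le`, and the event on which
the distances add up to a large number is the same for all partial sums. So mixing costs at most a
constant times `α(q)` per block, while the exponential bound is a power of `T` as small as desired.
The variances of the blocks grow linearly by a covariance inequality for mixing variables with `s`
moments.

The exponent `θ` makes `#G * (T / q) * α(q)` a negative power of `T` (`rate_exponent_neg`,
`mixing_rate_le`), and the union bound over the net and the windows finishes the proof.
-/

namespace KernelAvg

/-! ### Mixing and conditional expectations -/

section Dependence

variable {Ω : Type*} {𝓕 𝓖 : MeasurableSpace Ω} {mΩ : MeasurableSpace Ω}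

/-- The strong mixing coefficient of the pair `(𝓕, 𝓖)` of σ-algebras is at most `α`. -/
def AlphaBound {mΩ : MeasurableSpace Ω} (P : Measure Ω) (𝓕 𝓖 : MeasurableSpace Ω) (α : ℝ) : Prop :=
  ∀ A B : Set Ω, MeasurableSet[𝓖] A → MeasurableSet[𝓕] B →
    |P.real (A ∩ B) - P.real A * P.real B| ≤ α

variable {P : Measure Ω} {α b : ℝ}

theorem AlphaBound.mono_const {α' : ℝ} (h : AlphaBound P 𝓕 𝓖 α) (hα : α ≤ α') :
    AlphaBound P 𝓕 𝓖 α' := fun A B hA hB => (h A B hA hB).trans hα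

variable [IsProbabilityMeasure P]

theorem AlphaBound.bot_left (hα : 0 ≤ α) : AlphaBound P ⊥ 𝓖 α := by
  intro A B _ hB
  rcases MeasurableSpace.measurableSet_bot_iff.1 hB with rfl | rfl <;> simpa

theorem AlphaBound.bot_right (hα : 0 ≤ α) : AlphaBound P 𝓕 ⊥ α := by
  intro A B hA _
  rcases MeasurableSpace.measurableSet_bot_iff.1 hA with rfl | rfl <;> simpa

theorem integrable_of_abs_le {Y : Ω → ℝ} (hY : Measurable Y) (hb : ∀ ω, |Y ω| ≤ b) :
    Integrable Y P :=
  Integrable.of_bound hY.aestronglyMeasurable b (Eventually.of_forall hb)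

/-- The layer-cake formula turns the mixing bound for events into one for a bounded variable. -/
theorem AlphaBound.abs_setIntegral_sub_le (h : AlphaBound P 𝓕 𝓖 α) (hF : 𝓕 ≤ mΩ) (hG : 𝓖 ≤ mΩ)
    {Y : Ω → ℝ} (hY : Measurable[𝓖] Y) (h0 : ∀ ω, 0 ≤ Y ω) (hb : ∀ ω, Y ω ≤ b)
    {B : Set Ω} (hB : MeasurableSet[𝓕] B) :
    |∫ ω in B, Y ω ∂P - (∫ ω, Y ω ∂P) * P.real B| ≤ b * α := by
  have hYm : Measurable Y := hY.mono hG le_rfl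
  have hBm : MeasurableSet B := hF _ hB
  have hb0 : 0 ≤ b := by
    obtain ⟨ω⟩ := P.nonempty_of_neZero
    exact (h0 ω).trans (hb ω)
  have hint : ∀ Q : Measure Ω, [IsFiniteMeasure Q] → Integrable Y Q := fun Q _ =>
    Integrable.of_bound hYm.aestronglyMeasurable b
      (Eventually.of_forall fun ω => by rw [Real.norm_eq_abs, abs_of_nonneg (h0 ω)]; exact hb ω)
  have key : ∀ Q : Measure Ω, [IsFiniteMeasure Q] →
      ∫ ω, Y ω ∂Q = ∫ t in Set.Ioc 0 b, Q.real {ω | t < Y ω} := by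
    intro Q _
    rw [(hint Q).integral_eq_integral_meas_lt (Eventually.of_forall h0)]
    refine (setIntegral_eq_of_subset_of_forall_sdiff_eq_zero measurableSet_Ioi
      Set.Ioc_subset_Ioi_self ?_)
    rintro t ⟨ht, ht'⟩
    have : {ω | t < Y ω} = ∅ := by
      ext ω
      simp only [Set.mem_ofPred_eq, Set.mem_empty_iff_false, iff_false, not_lt]
      by_contra! hlt
      exact ht' ⟨ht, (hlt.le.trans (hb ω))⟩
    simp [this]
  have hanti : ∀ Q : Measure Ω, [IsFiniteMeasure Q] →
      IntegrableOn (fun t : ℝ => Q.real {ω | t < Y ω}) (Set.Ioc 0 b) := by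
    intro Q _
    have : Antitone (fun t : ℝ => Q.real {ω | t < Y ω}) := fun t t' htt =>
      measureReal_mono (fun ω (hω : t' < Y ω) => lt_of_le_of_lt htt hω)
    exact ((this.antitoneOn _).integrableOn_isCompact (isCompact_Icc (a := 0) (b := b))).mono_set
      Set.Ioc_subset_Icc_self
  rw [key P, key (P.restrict B), ← integral_mul_const,
    ← integral_sub (hanti _) ((hanti P).mul_const _)]
  have : ‖∫ t in Set.Ioc 0 b, ((P.restrict B).real {ω | t < Y ω}
      - P.real {ω | t < Y ω} * P.real B)‖ ≤ α * volume.real (Set.Ioc 0 b) := by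
    refine norm_setIntegral_le_of_norm_le_const (by simp) fun t _ => ?_
    have hm : MeasurableSet[𝓖] {ω | t < Y ω} := hY measurableSet_Ioi
    rw [measureReal_restrict_apply (hG _ hm)]
    exact h _ _ hm hB
  rw [Real.norm_eq_abs] at this
  simpa [hb0, mul_comm] using this

/-- Conditioning on a σ-algebra moves the mean of a bounded variable little in `L¹` when the two
are weakly dependent. -/
theorem AlphaBound.integral_abs_condExp_sub_le (h : AlphaBound P 𝓕 𝓖 α) (hF : 𝓕 ≤ mΩ)
    (hG : 𝓖 ≤ mΩ) {Y : Ω → ℝ} (hY : Measurable[𝓖] Y) (h0 : ∀ ω, 0 ≤ Y ω) (hb : ∀ ω, Y ω ≤ b) :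
    ∫ ω, |(P[Y|𝓕]) ω - ∫ ω', Y ω' ∂P| ∂P ≤ 2 * b * α := by
  have hYm : Measurable Y := hY.mono hG le_rfl
  have hYi : Integrable Y P := integrable_of_abs_le (b := b) hYm
    fun ω => by rw [abs_of_nonneg (h0 ω)]; exact hb ω
  set c := ∫ ω', Y ω' ∂P with hc
  set g : Ω → ℝ := P[Y|𝓕] with hg
  have hgm : Measurable[𝓕] g := stronglyMeasurable_condExp.measurable
  have hgi : Integrable g P := integrable_condExp
  set B : Set Ω := {ω | c ≤ g ω} with hBdef
  have hB : MeasurableSet[𝓕] B := hgm measurableSet_Ici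
  have hset : ∀ S : Set Ω, MeasurableSet[𝓕] S →
      ∫ ω in S, (g ω - c) ∂P = ∫ ω in S, Y ω ∂P - c * P.real S := by
    intro S hS
    rw [integral_sub hgi.integrableOn (integrable_const _).integrableOn, hg,
      setIntegral_condExp hF hYi hS]
    simp [mul_comm]
  have hi : Integrable (fun ω => |g ω - c|) P := (hgi.sub (integrable_const c)).abs
  rw [← integral_add_compl (hF _ hB) hi]
  have e1 : ∫ ω in B, |g ω - c| ∂P = ∫ ω in B, (g ω - c) ∂P :=
    setIntegral_congr_fun (hF _ hB) fun ω hω => abs_of_nonneg (sub_nonneg.2 hω)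
  have e2 : ∫ ω in Bᶜ, |g ω - c| ∂P = -∫ ω in Bᶜ, (g ω - c) ∂P := by
    rw [← integral_neg]
    refine setIntegral_congr_fun (hF _ hB.compl) fun ω hω => ?_
    exact abs_of_nonpos (sub_nonpos.2 (not_le.1 (show ¬ c ≤ g ω from hω)).le)
  rw [e1, e2, hset B hB, hset Bᶜ hB.compl]
  have b1 := h.abs_setIntegral_sub_le hF hG hY h0 hb hB
  have b2 := h.abs_setIntegral_sub_le hF hG hY h0 hb hB.compl
  have := (abs_le.1 b1).2
  have := (abs_le.1 b2).1
  linarith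

theorem AlphaBound.abs_cov_le (h : AlphaBound P 𝓕 𝓖 α) (hF : 𝓕 ≤ mΩ) (hG : 𝓖 ≤ mΩ)
    {X Y : Ω → ℝ} (hX : Measurable[𝓕] X) (hY : Measurable[𝓖] Y)
    (hXb : ∀ ω, |X ω| ≤ b) (hYb : ∀ ω, |Y ω| ≤ b) :
    |∫ ω, X ω * Y ω ∂P - (∫ ω, X ω ∂P) * ∫ ω, Y ω ∂P| ≤ 4 * α * b ^ 2 := by
  have hb0 : 0 ≤ b := by
    obtain ⟨ω⟩ := P.nonempty_of_neZero
    exact (abs_nonneg _).trans (hXb ω)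
  have hXm : Measurable X := hX.mono hF le_rfl
  have hYm : Measurable Y := hY.mono hG le_rfl
  have hXi : Integrable X P := integrable_of_abs_le hXm hXb
  have hYi : Integrable Y P := integrable_of_abs_le hYm hYb
  set Z : Ω → ℝ := fun ω => Y ω + b with hZ
  have hZi : Integrable Z P := hYi.add (integrable_const b)
  have hZm : Measurable[𝓖] Z := hY.add_const b
  have hL := h.integral_abs_condExp_sub_le hF hG hZm (b := 2 * b)
    (fun ω => by have := (abs_le.1 (hYb ω)).1; simp only [hZ]; linarith)
    (fun ω => by have := (abs_le.1 (hYb ω)).2; simp only [hZ]; linarith)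
  set c := ∫ ω', Z ω' ∂P with hc
  set g : Ω → ℝ := P[Z|𝓕] with hg
  have hgi : Integrable g P := integrable_condExp
  have hXZ : Integrable (fun ω => X ω * Z ω) P :=
    hZi.bdd_mul hXm.aestronglyMeasurable (c := b) (Eventually.of_forall hXb)
  have hXY : Integrable (fun ω => X ω * Y ω) P :=
    hYi.bdd_mul hXm.aestronglyMeasurable (c := b) (Eventually.of_forall hXb)
  have hXg : Integrable (fun ω => X ω * g ω) P :=
    hgi.bdd_mul hXm.aestronglyMeasurable (c := b) (Eventually.of_forall hXb)
  have h1 : ∫ ω, X ω * Z ω ∂P = ∫ ω, X ω * g ω ∂P := by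
    rw [← integral_condExp hF]
    exact integral_congr_ae (condExp_mul_of_stronglyMeasurable_left hX.stronglyMeasurable hXZ hZi)
  have h2 : ∫ ω, X ω * Z ω ∂P = ∫ ω, X ω * Y ω ∂P + b * ∫ ω, X ω ∂P := by
    rw [← integral_const_mul, ← integral_add hXY (hXi.const_mul b)]
    congr 1; ext ω; simp only [hZ]; ring
  have h3 : c = ∫ ω, Y ω ∂P + b := by
    rw [hc, hZ, integral_add hYi (integrable_const b)]; simp
  have h4 : ∫ ω, X ω * Y ω ∂P - (∫ ω, X ω ∂P) * ∫ ω, Y ω ∂P = ∫ ω, X ω * (g ω - c) ∂P := by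
    have : ∫ ω, X ω * (g ω - c) ∂P = ∫ ω, X ω * g ω ∂P - (∫ ω, X ω ∂P) * c := by
      rw [← integral_mul_const, ← integral_sub hXg (hXi.mul_const c)]
      congr 1; ext ω; ring
    rw [this, ← h1, h2, h3]; ring
  rw [h4]
  have hi : Integrable (fun ω => |g ω - c|) P := (hgi.sub (integrable_const c)).abs
  calc |∫ ω, X ω * (g ω - c) ∂P| ≤ ∫ ω, |X ω * (g ω - c)| ∂P := abs_integral_le_integral_abs
    _ ≤ ∫ ω, b * |g ω - c| ∂P := by
        refine integral_mono_of_nonneg (Eventually.of_forall fun ω => abs_nonneg _)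
          (hi.const_mul b) (Eventually.of_forall fun ω => ?_)
        simp only [abs_mul]
        exact mul_le_mul_of_nonneg_right (hXb ω) (abs_nonneg _)
    _ = b * ∫ ω, |g ω - c| ∂P := integral_const_mul _ _
    _ ≤ b * (2 * (2 * b) * α) := mul_le_mul_of_nonneg_left hL hb0
    _ = 4 * α * b ^ 2 := by ring

end Dependence

/-! ### An exponential inequality for weakly dependent blocks -/

section Exponential

variable {Ω : Type*} {mΩ : MeasurableSpace Ω} {P : Measure Ω} [IsProbabilityMeasure P]

theorem exp_le_one_add_add_sq {x : ℝ} (hx : |x| ≤ 1) : Real.exp x ≤ 1 + x + x ^ 2 := by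
  have := (abs_le.1 (Real.abs_exp_sub_one_sub_id_le hx)).2
  linarith

/-- A Bernstein inequality for weakly dependent blocks `B 0, …, B (p - 1)`. The product of
`exp (B k)` divided by `G k = max (E[exp (B k) | 𝓕 k]) e⁻¹` has mean at most one, and
`∑ log G k ≤ ∑ |G k - E exp (B k)| + ∑ E (B k)²`. The `L¹` distance of `G k` from
`E exp (B k)` is what mixing controls, and the event on which these distances add up to a
large number does not depend on the partial sum. -/
theorem measure_exists_sum_ge_le {p : ℕ} {B : ℕ → Ω → ℝ} {𝓕 𝓖 : ℕ → MeasurableSpace Ω}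
    {α v y : ℝ} (hF : ∀ k, 𝓕 k ≤ mΩ) (hG : ∀ k, 𝓖 k ≤ mΩ) (hmono : Monotone 𝓕)
    (hBF : ∀ k, Measurable[𝓕 (k + 1)] (B k)) (hBG : ∀ k, Measurable[𝓖 k] (B k))
    (hmix : ∀ k, AlphaBound P (𝓕 k) (𝓖 k) α) (hB1 : ∀ k ω, |B k ω| ≤ 1)
    (hmean : ∀ k, ∫ ω, B k ω ∂P = 0) (hvar : ∀ k, ∫ ω, B k ω ^ 2 ∂P ≤ v)
    (hy : 0 < y) (hv : p * v ≤ y / 4) :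
    P.real {ω | ∃ l ≤ p, y ≤ ∑ k ∈ Finset.range l, B k ω} ≤
      (p + 1) * Real.exp (-(y / 2)) + 4 / y * (p * (2 * Real.exp 1 * α)) := by
  have hBm : ∀ k, Measurable (B k) := fun k => (hBG k).mono (hG k) le_rfl
  have hBi : ∀ k, Integrable (B k) P := fun k => integrable_of_abs_le (hBm k) (hB1 k)
  have hB2i : ∀ k, Integrable (fun ω => B k ω ^ 2) P := fun k =>
    integrable_of_abs_le (b := 1) ((hBm k).pow_const 2) fun ω => by
      rw [abs_pow]; exact pow_le_one₀ (abs_nonneg _) (hB1 k ω)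
  set E : ℕ → Ω → ℝ := fun k ω => Real.exp (B k ω) with hE
  have hEpos : ∀ k ω, 0 < E k ω := fun k ω => Real.exp_pos _
  have hEle : ∀ k ω, E k ω ≤ Real.exp 1 := fun k ω =>
    Real.exp_le_exp.2 (abs_le.1 (hB1 k ω)).2
  have hEge : ∀ k ω, Real.exp (-1) ≤ E k ω := fun k ω =>
    Real.exp_le_exp.2 (abs_le.1 (hB1 k ω)).1
  have hEm : ∀ k, Measurable (E k) := fun k => (hBm k).exp
  have hEG : ∀ k, Measurable[𝓖 k] (E k) := fun k => Real.measurable_exp.comp (hBG k)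
  have hEF : ∀ k, Measurable[𝓕 (k + 1)] (E k) := fun k => Real.measurable_exp.comp (hBF k)
  have hEi : ∀ k, Integrable (E k) P := fun k => integrable_of_abs_le (b := Real.exp 1) (hEm k)
    fun ω => by rw [abs_of_pos (hEpos k ω)]; exact hEle k ω
  set c : ℕ → ℝ := fun k => ∫ ω, E k ω ∂P with hc
  have hcge : ∀ k, Real.exp (-1) ≤ c k := by
    intro k
    have := integral_mono (μ := P) (integrable_const (Real.exp (-1))) (hEi k) (hEge k)
    simpa using this
  have hcle : ∀ k, c k - 1 ≤ v := by
    intro k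
    have h1 : c k ≤ ∫ ω, (1 + B k ω + B k ω ^ 2) ∂P :=
      integral_mono (hEi k) (((integrable_const _).add (hBi k)).add (hB2i k))
        fun ω => exp_le_one_add_add_sq (hB1 k ω)
    have h2 : ∫ ω, (1 + B k ω + B k ω ^ 2) ∂P = 1 + ∫ ω, B k ω ^ 2 ∂P := by
      have h3 : Integrable (fun ω => 1 + B k ω) P := (integrable_const _).add (hBi k)
      rw [integral_add h3 (hB2i k), integral_add (integrable_const _) (hBi k), hmean k]
      simp
    linarith [hvar k]
  set G : ℕ → Ω → ℝ := fun k ω => max ((P[E k|𝓕 k]) ω) (Real.exp (-1)) with hGdef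
  have hGF : ∀ k, Measurable[𝓕 k] (G k) := fun k =>
    (stronglyMeasurable_condExp.measurable).max measurable_const
  have hGge : ∀ k ω, Real.exp (-1) ≤ G k ω := fun k ω => le_max_right _ _
  have hGpos : ∀ k ω, 0 < G k ω := fun k ω => (Real.exp_pos _).trans_le (hGge k ω)
  have hGm : ∀ k, Measurable (G k) := fun k => (hGF k).mono (hF k) le_rfl
  -- `max` with `e⁻¹` is a contraction that fixes `c k`, so it does not enlarge the distance.
  have hGc : ∀ k ω, |G k ω - c k| ≤ |(P[E k|𝓕 k]) ω - c k| := by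
    intro k ω
    have := abs_max_sub_max_le_abs ((P[E k|𝓕 k]) ω) (c k) (Real.exp (-1))
    rwa [max_eq_left (hcge k)] at this
  have hdi : ∀ k, Integrable (fun ω => |(P[E k|𝓕 k]) ω - c k|) P := fun k =>
    (integrable_condExp.sub (integrable_const _)).abs
  have hGci : ∀ k, Integrable (fun ω => |G k ω - c k|) P := fun k =>
    (hdi k).mono' ((hGm k).sub_const _).abs.aestronglyMeasurable
      (Eventually.of_forall fun ω => by rw [Real.norm_eq_abs, abs_abs]; exact hGc k ω)
  have hGL : ∀ k, ∫ ω, |G k ω - c k| ∂P ≤ 2 * Real.exp 1 * α := fun k =>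
    (integral_mono (hGci k) (hdi k) (hGc k)).trans
      ((hmix k).integral_abs_condExp_sub_le (hF k) (hG k) (hEG k) (fun ω => (hEpos k ω).le)
        (hEle k))
  set R : ℕ → Ω → ℝ := fun l ω => ∏ k ∈ Finset.range l, E k ω / G k ω with hR
  have hRF : ∀ l, Measurable[𝓕 l] (R l) := by
    intro l
    refine Finset.measurable_fun_prod _ fun k hk => ?_
    have hk' : k + 1 ≤ l := Finset.mem_range.1 hk
    exact ((hEF k).mono (hmono hk') le_rfl).div ((hGF k).mono (hmono (by omega)) le_rfl)
  have hRpos : ∀ l ω, 0 < R l ω := fun l ω =>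
    Finset.prod_pos fun k _ => div_pos (hEpos k ω) (hGpos k ω)
  have hRle : ∀ l ω, R l ω ≤ Real.exp 2 ^ l := by
    intro l ω
    calc R l ω ≤ ∏ k ∈ Finset.range l, Real.exp 2 := by
          refine Finset.prod_le_prod (fun k _ => (div_pos (hEpos k ω) (hGpos k ω)).le)
            fun k _ => ?_
          rw [div_le_iff₀ (hGpos k ω)]
          calc E k ω ≤ Real.exp 1 := hEle k ω
            _ = Real.exp 2 * Real.exp (-1) := by rw [← Real.exp_add]; norm_num
            _ ≤ Real.exp 2 * G k ω :=
                mul_le_mul_of_nonneg_left (hGge k ω) (Real.exp_pos _).le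
      _ = Real.exp 2 ^ l := by simp
  have hRm : ∀ l, Measurable (R l) := fun l => (hRF l).mono (hF l) le_rfl
  have hRi : ∀ l, Integrable (R l) P := fun l => integrable_of_abs_le (b := Real.exp 2 ^ l)
    (hRm l) fun ω => by rw [abs_of_pos (hRpos l ω)]; exact hRle l ω
  have hRint : ∀ l, ∫ ω, R l ω ∂P ≤ 1 := by
    intro l
    induction l with
    | zero => simp [hR]
    | succ l ih =>
      refine le_trans ?_ ih
      set U : Ω → ℝ := fun ω => R l ω / G l ω with hU
      have hUF : Measurable[𝓕 l] U := (hRF l).div (hGF l)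
      have hUm : Measurable U := hUF.mono (hF l) le_rfl
      have hUpos : ∀ ω, 0 < U ω := fun ω => div_pos (hRpos l ω) (hGpos l ω)
      have hUb : ∀ ω, ‖U ω‖ ≤ Real.exp 2 ^ l * Real.exp 1 := by
        intro ω
        rw [Real.norm_eq_abs, abs_of_pos (hUpos ω), hU]
        simp only
        rw [div_le_iff₀ (hGpos l ω), mul_assoc]
        have : 1 ≤ Real.exp 1 * G l ω := by
          calc (1 : ℝ) = Real.exp 1 * Real.exp (-1) := by rw [← Real.exp_add]; norm_num
            _ ≤ _ := mul_le_mul_of_nonneg_left (hGge l ω) (Real.exp_pos _).le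
        calc R l ω ≤ Real.exp 2 ^ l := hRle l ω
          _ ≤ _ := le_mul_of_one_le_right (by positivity) this
      have hUE : Integrable (fun ω => U ω * E l ω) P :=
        (hEi l).bdd_mul hUm.aestronglyMeasurable (Eventually.of_forall hUb)
      have hUC : Integrable (fun ω => U ω * (P[E l|𝓕 l]) ω) P :=
        (integrable_condExp).bdd_mul hUm.aestronglyMeasurable (Eventually.of_forall hUb)
      have e1 : ∫ ω, R (l + 1) ω ∂P = ∫ ω, U ω * E l ω ∂P := by
        congr 1; ext ω
        simp only [hR, hU, Finset.prod_range_succ]; ring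
      have e2 : ∫ ω, U ω * E l ω ∂P = ∫ ω, U ω * (P[E l|𝓕 l]) ω ∂P := by
        rw [← integral_condExp (hF l)]
        exact integral_congr_ae
          (condExp_mul_of_stronglyMeasurable_left hUF.stronglyMeasurable hUE (hEi l))
      rw [e1, e2]
      refine integral_mono hUC (hRi l) fun ω => ?_
      calc U ω * (P[E l|𝓕 l]) ω ≤ U ω * G l ω :=
            mul_le_mul_of_nonneg_left (le_max_left _ _) (hUpos ω).le
        _ = R l ω := div_mul_cancel₀ _ (hGpos l ω).ne'
  set D : Ω → ℝ := fun ω => ∑ k ∈ Finset.range p, |G k ω - c k| with hD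
  have hDi : Integrable D P := integrable_finsetSum _ fun k _ => hGci k
  have hDint : ∫ ω, D ω ∂P ≤ p * (2 * Real.exp 1 * α) := by
    rw [hD, integral_finsetSum _ fun k _ => hGci k]
    calc _ ≤ ∑ k ∈ Finset.range p, 2 * Real.exp 1 * α := Finset.sum_le_sum fun k _ => hGL k
      _ = _ := by simp
  have hv0 : 0 ≤ v := (integral_nonneg fun ω => sq_nonneg _).trans (hvar 0)
  have hsub : {ω | ∃ l ≤ p, y ≤ ∑ k ∈ Finset.range l, B k ω} ⊆
      (⋃ l ∈ Finset.range (p + 1), {ω | Real.exp (y / 2) ≤ R l ω}) ∪ {ω | y / 4 ≤ D ω} := by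
    rintro ω ⟨l, hl, hyl⟩
    by_cases hDω : y / 4 ≤ D ω
    · exact Or.inr hDω
    refine Or.inl ?_
    simp only [Set.mem_iUnion, Finset.mem_range, Set.mem_ofPred_eq]
    refine ⟨l, by omega, ?_⟩
    have hlog : ∑ k ∈ Finset.range l, Real.log (G k ω) ≤ y / 2 := by
      calc ∑ k ∈ Finset.range l, Real.log (G k ω)
          ≤ ∑ k ∈ Finset.range l, (|G k ω - c k| + v) := by
            refine Finset.sum_le_sum fun k _ => ?_
            have h1 := Real.log_le_sub_one_of_pos (hGpos k ω)
            have h2 := le_abs_self (G k ω - c k)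
            have h3 := hcle k
            linarith
        _ ≤ ∑ k ∈ Finset.range p, (|G k ω - c k| + v) :=
            Finset.sum_le_sum_of_subset_of_nonneg (Finset.range_mono hl)
              fun k _ _ => add_nonneg (abs_nonneg _) hv0
        _ = D ω + p * v := by rw [Finset.sum_add_distrib]; simp [hD]
        _ ≤ y / 2 := by linarith [not_le.1 hDω]
    rw [← Real.le_log_iff_exp_le (hRpos l ω), hR]
    simp only
    rw [Real.log_prod fun k _ => (div_pos (hEpos k ω) (hGpos k ω)).ne']
    have : ∀ k, Real.log (E k ω / G k ω) = B k ω - Real.log (G k ω) := fun k => by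
      rw [Real.log_div (hEpos k ω).ne' (hGpos k ω).ne']; simp [hE]
    simp only [this, Finset.sum_sub_distrib]
    linarith
  have hPR : ∀ l, P.real {ω | Real.exp (y / 2) ≤ R l ω} ≤ Real.exp (-(y / 2)) := by
    intro l
    have := mul_meas_ge_le_integral_of_nonneg (μ := P)
      (Eventually.of_forall fun ω => (hRpos l ω).le) (hRi l) (Real.exp (y / 2))
    have h2 := this.trans (hRint l)
    rw [Real.exp_neg, ← one_div, le_div_iff₀ (Real.exp_pos _), mul_comm]
    exact h2
  have hPD : P.real {ω | y / 4 ≤ D ω} ≤ 4 / y * (p * (2 * Real.exp 1 * α)) := by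
    have := mul_meas_ge_le_integral_of_nonneg (μ := P)
      (Eventually.of_forall fun ω => Finset.sum_nonneg fun k _ => abs_nonneg (G k ω - c k))
      hDi (y / 4)
    have h2 := this.trans hDint
    rw [div_mul_eq_mul_div, le_div_iff₀ hy]
    linarith
  calc _ ≤ P.real ((⋃ l ∈ Finset.range (p + 1), {ω | Real.exp (y / 2) ≤ R l ω}) ∪
        {ω | y / 4 ≤ D ω}) := measureReal_mono hsub
    _ ≤ P.real (⋃ l ∈ Finset.range (p + 1), {ω | Real.exp (y / 2) ≤ R l ω}) +
        P.real {ω | y / 4 ≤ D ω} := measureReal_union_le _ _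
    _ ≤ ∑ l ∈ Finset.range (p + 1), Real.exp (-(y / 2)) + _ :=
        add_le_add ((measureReal_biUnion_finset_le _ _).trans
          (Finset.sum_le_sum fun l _ => hPR l)) hPD
    _ = _ := by simp

end Exponential

/-! ### Truncation -/

section Clamp

/-- Truncation of `x` to the interval `[-u, u]`. -/
def clamp (u x : ℝ) : ℝ := max (-u) (min u x)

theorem measurable_clamp (u : ℝ) : Measurable (clamp u) :=
  measurable_const.max (measurable_const.min measurable_id)

theorem clamp_of_abs_le {u x : ℝ} (h : |x| ≤ u) : clamp u x = x := by
  obtain ⟨h1, h2⟩ := abs_le.1 h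
  rw [clamp, min_eq_right h2, max_eq_right h1]

theorem abs_clamp_le {u : ℝ} (hu : 0 ≤ u) (x : ℝ) : |clamp u x| ≤ u :=
  abs_le.2 ⟨le_max_left _ _, max_le (by linarith) (min_le_left _ _)⟩

theorem abs_clamp_le_abs {u : ℝ} (hu : 0 ≤ u) (x : ℝ) : |clamp u x| ≤ |x| := by
  by_cases h : |x| ≤ u
  · rw [clamp_of_abs_le h]
  · exact (abs_clamp_le hu x).trans (not_le.1 h).le

theorem abs_sub_clamp_le_abs {u : ℝ} (hu : 0 ≤ u) (x : ℝ) : |x - clamp u x| ≤ |x| := by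
  rcases le_total 0 x with hx | hx
  · have h1 : clamp u x = min u x := max_eq_right (by
      have := le_min hu hx; linarith)
    rw [h1, abs_of_nonneg (by linarith [min_le_right u x]), abs_of_nonneg hx]
    linarith [le_min hu hx]
  · have h1 : clamp u x = max (-u) x := by rw [clamp, min_eq_right (hx.trans hu)]
    rw [h1, abs_of_nonpos (by linarith [le_max_right (-u) x]), abs_of_nonpos hx]
    linarith [max_le (neg_nonpos.2 hu) hx]

theorem abs_sub_clamp_le_rpow {u s : ℝ} (hu : 0 < u) (hs : 1 ≤ s) (x : ℝ) :
    |x - clamp u x| ≤ u ^ (1 - s) * |x| ^ s := by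
  by_cases h : |x| ≤ u
  · rw [clamp_of_abs_le h, sub_self, abs_zero]; positivity
  have h' := not_le.1 h
  have hx : 0 < |x| := hu.trans h'
  calc |x - clamp u x| ≤ |x| := abs_sub_clamp_le_abs hu.le x
    _ = |x| ^ (1 - s) * |x| ^ s := by rw [← Real.rpow_add hx]; simp
    _ ≤ u ^ (1 - s) * |x| ^ s := mul_le_mul_of_nonneg_right
        (Real.rpow_le_rpow_of_nonpos hu h'.le (by linarith)) (by positivity)

theorem sq_le_rpow_mul_rpow {u s z : ℝ} (hu : 0 < u) (hs : 2 ≤ s) (hz : u ≤ z) :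
    z ^ 2 ≤ u ^ (2 - s) * z ^ s := by
  have hz0 : 0 < z := hu.trans_le hz
  calc z ^ 2 = z ^ (2 - s) * z ^ s := by rw [← Real.rpow_add hz0]; simp
    _ ≤ u ^ (2 - s) * z ^ s := mul_le_mul_of_nonneg_right
        (Real.rpow_le_rpow_of_nonpos hu hz (by linarith)) (by positivity)

theorem abs_sub_clamp_mul_abs_le {u s : ℝ} (hu : 0 < u) (hs : 2 ≤ s) (x y : ℝ) :
    |x - clamp u x| * |y| ≤ u ^ (2 - s) * (|x| ^ s + |y| ^ s) := by
  by_cases h : |x| ≤ u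
  · rw [clamp_of_abs_le h, sub_self, abs_zero, zero_mul]; positivity
  have h' := not_le.1 h
  have h1 : |x - clamp u x| * |y| ≤ |x| * |y| :=
    mul_le_mul_of_nonneg_right (abs_sub_clamp_le_abs hu.le x) (abs_nonneg _)
  have hxs : 0 ≤ u ^ (2 - s) * |x| ^ s := by positivity
  have hys : 0 ≤ u ^ (2 - s) * |y| ^ s := by positivity
  rcases le_total |y| |x| with hxy | hxy
  · have := sq_le_rpow_mul_rpow hu hs h'.le
    nlinarith [mul_le_mul_of_nonneg_left hxy (abs_nonneg x)]
  · have := sq_le_rpow_mul_rpow hu hs (h'.le.trans hxy)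
    nlinarith [mul_le_mul_of_nonneg_right hxy (abs_nonneg y)]

theorem abs_mul_sub_clamp_mul_clamp_le {u s : ℝ} (hu : 0 < u) (hs : 2 ≤ s) (x y : ℝ) :
    |x * y - clamp u x * clamp u y| ≤ 2 * u ^ (2 - s) * (|x| ^ s + |y| ^ s) := by
  have h1 := abs_sub_clamp_mul_abs_le hu hs x y
  have h2 := abs_sub_clamp_mul_abs_le hu hs y x
  have h3 : |clamp u x * (y - clamp u y)| ≤ |y - clamp u y| * |x| := by
    rw [abs_mul, mul_comm]
    exact mul_le_mul_of_nonneg_left (abs_clamp_le_abs hu.le x) (abs_nonneg _)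
  calc |x * y - clamp u x * clamp u y|
      = |(x - clamp u x) * y + clamp u x * (y - clamp u y)| := by congr 1; ring
    _ ≤ |(x - clamp u x) * y| + |clamp u x * (y - clamp u y)| := abs_add_le _ _
    _ ≤ _ := by rw [abs_mul]; linarith

theorem abs_le_one_add_rpow {s : ℝ} (hs : 1 ≤ s) (x : ℝ) : |x| ≤ 1 + |x| ^ s := by
  rcases le_total |x| 1 with h | h
  · have : 0 ≤ |x| ^ s := by positivity
    linarith
  · have := Real.self_le_rpow_of_one_le h hs
    linarith

theorem sq_le_one_add_rpow {s : ℝ} (hs : 2 ≤ s) (x : ℝ) : x ^ 2 ≤ 1 + |x| ^ s := by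
  rw [← sq_abs]
  rcases le_total |x| 1 with h | h
  · have h1 : 0 ≤ |x| ^ s := by positivity
    have h2 : |x| ^ 2 ≤ 1 := pow_le_one₀ (abs_nonneg _) h
    linarith
  · have := Real.rpow_le_rpow_of_exponent_le h hs
    rw [Real.rpow_two] at this
    linarith

end Clamp

/-! ### Covariances and second moments of sums -/

section Covariance

variable {Ω : Type*} {𝓕 𝓖 : MeasurableSpace Ω} {mΩ : MeasurableSpace Ω} {P : Measure Ω}
  [IsProbabilityMeasure P]

theorem integrable_rpow_of_abs_le {X : Ω → ℝ} {b s : ℝ} (hX : Measurable X) (hs : 0 ≤ s)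
    (hb : ∀ ω, |X ω| ≤ b) : Integrable (fun ω => |X ω| ^ s) P :=
  integrable_of_abs_le (b := b ^ s) (hX.abs.pow_const s) fun ω => by
    rw [abs_of_nonneg (by positivity)]
    exact Real.rpow_le_rpow (abs_nonneg _) (hb ω) hs

theorem integral_abs_le_of_integral_rpow_le {X : Ω → ℝ} {s μ : ℝ} (hs : 1 ≤ s) (hμ : 1 ≤ μ)
    (hXs : Integrable (fun ω => |X ω| ^ s) P) (hXμ : ∫ ω, |X ω| ^ s ∂P ≤ μ) :
    |∫ ω, X ω ∂P| ≤ 2 * μ := by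
  calc |∫ ω, X ω ∂P| ≤ ∫ ω, |X ω| ∂P := abs_integral_le_integral_abs
    _ ≤ ∫ ω, (1 + |X ω| ^ s) ∂P :=
        integral_mono_of_nonneg (Eventually.of_forall fun ω => abs_nonneg _)
          ((integrable_const _).add hXs)
          (Eventually.of_forall fun ω => abs_le_one_add_rpow hs (X ω))
    _ = 1 + ∫ ω, |X ω| ^ s ∂P := by rw [integral_add (integrable_const _) hXs]; simp
    _ ≤ 2 * μ := by linarith

/-- A covariance inequality for variables with bounded `s`-th moments: both are truncated at the
free level `u`. The bound `b` only guarantees integrability. -/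
theorem AlphaBound.abs_cov_le_of_moment {X Y : Ω → ℝ} {α b s μ u : ℝ}
    (h : AlphaBound P 𝓕 𝓖 α) (hF : 𝓕 ≤ mΩ) (hG : 𝓖 ≤ mΩ)
    (hX : Measurable[𝓕] X) (hY : Measurable[𝓖] Y) (hXb : ∀ ω, |X ω| ≤ b) (hYb : ∀ ω, |Y ω| ≤ b)
    (hs : 2 ≤ s) (hμ : 1 ≤ μ) (hXμ : ∫ ω, |X ω| ^ s ∂P ≤ μ) (hYμ : ∫ ω, |Y ω| ^ s ∂P ≤ μ)
    (hu : 1 ≤ u) :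
    |∫ ω, X ω * Y ω ∂P - (∫ ω, X ω ∂P) * ∫ ω, Y ω ∂P| ≤
      4 * α * u ^ 2 + 8 * μ ^ 2 * u ^ (2 - s) := by
  have hu0 : 0 < u := by linarith
  have hb0 : 0 ≤ b := by
    obtain ⟨ω⟩ := P.nonempty_of_neZero
    exact (abs_nonneg _).trans (hXb ω)
  have hXm : Measurable X := hX.mono hF le_rfl
  have hYm : Measurable Y := hY.mono hG le_rfl
  set X' : Ω → ℝ := fun ω => clamp u (X ω) with hX'
  set Y' : Ω → ℝ := fun ω => clamp u (Y ω) with hY'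
  have hX'F : Measurable[𝓕] X' := (measurable_clamp u).comp hX
  have hY'G : Measurable[𝓖] Y' := (measurable_clamp u).comp hY
  have hX'm : Measurable X' := hX'F.mono hF le_rfl
  have hY'm : Measurable Y' := hY'G.mono hG le_rfl
  have hX'b : ∀ ω, |X' ω| ≤ u := fun ω => abs_clamp_le hu0.le _
  have hY'b : ∀ ω, |Y' ω| ≤ u := fun ω => abs_clamp_le hu0.le _
  have hcov := h.abs_cov_le hF hG hX'F hY'G hX'b hY'b
  have hXs : Integrable (fun ω => |X ω| ^ s) P :=
    integrable_rpow_of_abs_le hXm (by linarith) hXb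
  have hYs : Integrable (fun ω => |Y ω| ^ s) P :=
    integrable_rpow_of_abs_le hYm (by linarith) hYb
  have hXi : Integrable X P := integrable_of_abs_le hXm hXb
  have hYi : Integrable Y P := integrable_of_abs_le hYm hYb
  have hX'i : Integrable X' P := integrable_of_abs_le hX'm hX'b
  have hY'i : Integrable Y' P := integrable_of_abs_le hY'm hY'b
  have hXY : Integrable (fun ω => X ω * Y ω) P :=
    hYi.bdd_mul hXm.aestronglyMeasurable (c := b) (Eventually.of_forall hXb)
  have hXY' : Integrable (fun ω => X' ω * Y' ω) P :=
    hY'i.bdd_mul hX'm.aestronglyMeasurable (c := u) (Eventually.of_forall hX'b)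
  have hp0 : 0 ≤ u ^ (2 - s) := by positivity
  have d1 : |∫ ω, X ω * Y ω ∂P - ∫ ω, X' ω * Y' ω ∂P| ≤ 4 * u ^ (2 - s) * μ := by
    rw [← integral_sub hXY hXY']
    calc |∫ ω, (X ω * Y ω - X' ω * Y' ω) ∂P| ≤ ∫ ω, |X ω * Y ω - X' ω * Y' ω| ∂P :=
          abs_integral_le_integral_abs
      _ ≤ ∫ ω, 2 * u ^ (2 - s) * (|X ω| ^ s + |Y ω| ^ s) ∂P :=
          integral_mono_of_nonneg (Eventually.of_forall fun ω => abs_nonneg _)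
            ((hXs.add hYs).const_mul _)
            (Eventually.of_forall fun ω => abs_mul_sub_clamp_mul_clamp_le hu0 hs _ _)
      _ = 2 * u ^ (2 - s) * (∫ ω, |X ω| ^ s ∂P + ∫ ω, |Y ω| ^ s ∂P) := by
          rw [integral_const_mul, integral_add hXs hYs]
      _ ≤ _ := by nlinarith
  have hm : ∀ Z : Ω → ℝ, Measurable Z → (∀ ω, |Z ω| ≤ b) → ∫ ω, |Z ω| ^ s ∂P ≤ μ →
      |∫ ω, Z ω ∂P - ∫ ω, clamp u (Z ω) ∂P| ≤ u ^ (2 - s) * μ ∧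
      |∫ ω, Z ω ∂P| ≤ 2 * μ ∧ |∫ ω, clamp u (Z ω) ∂P| ≤ 2 * μ := by
    intro Z hZ hZb hZμ
    have hZs : Integrable (fun ω => |Z ω| ^ s) P :=
      integrable_rpow_of_abs_le hZ (by linarith) hZb
    have hZi : Integrable Z P := integrable_of_abs_le hZ hZb
    have hcm : Measurable fun ω => clamp u (Z ω) := (measurable_clamp u).comp hZ
    have hci : Integrable (fun ω => clamp u (Z ω)) P :=
      integrable_of_abs_le hcm fun ω => abs_clamp_le hu0.le (Z ω)
    refine ⟨?_, integral_abs_le_of_integral_rpow_le (s := s) (by linarith) hμ hZs hZμ,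
      integral_abs_le_of_integral_rpow_le (s := s) (by linarith) hμ
        (integrable_rpow_of_abs_le hcm (by linarith) fun ω => abs_clamp_le hu0.le (Z ω)) ?_⟩
    · rw [← integral_sub hZi hci]
      calc |∫ ω, (Z ω - clamp u (Z ω)) ∂P| ≤ ∫ ω, |Z ω - clamp u (Z ω)| ∂P :=
            abs_integral_le_integral_abs
        _ ≤ ∫ ω, u ^ (2 - s) * |Z ω| ^ s ∂P := by
            refine integral_mono_of_nonneg (Eventually.of_forall fun ω => abs_nonneg _)
              (hZs.const_mul _) (Eventually.of_forall fun ω => ?_)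
            refine (abs_sub_clamp_le_rpow (s := s) hu0 (by linarith) (Z ω)).trans ?_
            exact mul_le_mul_of_nonneg_right
              (Real.rpow_le_rpow_of_exponent_le hu (by linarith)) (by positivity)
        _ = u ^ (2 - s) * ∫ ω, |Z ω| ^ s ∂P := integral_const_mul _ _
        _ ≤ _ := mul_le_mul_of_nonneg_left hZμ hp0
    · refine le_trans ?_ hZμ
      exact integral_mono_of_nonneg (Eventually.of_forall fun ω => by positivity) hZs
        (Eventually.of_forall fun ω => Real.rpow_le_rpow (abs_nonneg _)
          (abs_clamp_le_abs hu0.le _) (by linarith))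
  obtain ⟨x1, x2, x3⟩ := hm X hXm hXb hXμ
  obtain ⟨y1, y2, y3⟩ := hm Y hYm hYb hYμ
  set eX := ∫ ω, X ω ∂P
  set eY := ∫ ω, Y ω ∂P
  have d2 : |(∫ ω, X' ω ∂P) * ∫ ω, Y' ω ∂P - eX * eY| ≤ 4 * u ^ (2 - s) * μ ^ 2 := by
    have : (∫ ω, X' ω ∂P) * ∫ ω, Y' ω ∂P - eX * eY =
        -((eX - ∫ ω, X' ω ∂P) * eY + (∫ ω, X' ω ∂P) * (eY - ∫ ω, Y' ω ∂P)) := by ring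
    rw [this, abs_neg]
    refine (abs_add_le _ _).trans ?_
    rw [abs_mul, abs_mul]
    have e1 := mul_le_mul x1 y2 (abs_nonneg _) (by positivity)
    have e2 := mul_le_mul x3 y1 (abs_nonneg _) (by positivity)
    linarith
  calc |∫ ω, X ω * Y ω ∂P - eX * eY|
      ≤ |∫ ω, X ω * Y ω ∂P - ∫ ω, X' ω * Y' ω ∂P| +
        |∫ ω, X' ω * Y' ω ∂P - (∫ ω, X' ω ∂P) * ∫ ω, Y' ω ∂P| +
        |(∫ ω, X' ω ∂P) * ∫ ω, Y' ω ∂P - eX * eY| :=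
      (abs_sub_le _ _ _).trans (add_le_add_left (abs_sub_le _ _ _) _)
    _ ≤ 4 * u ^ (2 - s) * μ + 4 * α * u ^ 2 + 4 * u ^ (2 - s) * μ ^ 2 :=
      add_le_add (add_le_add d1 hcov) d2
    _ ≤ _ := by nlinarith [mul_le_mul_of_nonneg_left (mul_le_mul_of_nonneg_left hμ
        (by linarith : (0:ℝ) ≤ μ)) hp0]

/-- With covariances that are summable in the lag, the second moment of a sum grows linearly. -/
theorem integral_sq_sum_le {Y : ℕ → Ω → ℝ} {b c v η : ℝ} (hη : 1 < η)
    (hY : ∀ i, Measurable (Y i)) (hb : ∀ i ω, |Y i ω| ≤ b) (hc : 0 ≤ c)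
    (hv : ∀ i, ∫ ω, Y i ω ^ 2 ∂P ≤ v)
    (hcov : ∀ i l, i < l → |∫ ω, Y i ω * Y l ω ∂P| ≤ c * ((l - i : ℕ) : ℝ) ^ (-η)) (k q : ℕ) :
    ∫ ω, (∑ i ∈ Finset.range q, Y (k + i) ω) ^ 2 ∂P ≤
      q * (v + 2 * c * ∑' n : ℕ, (n : ℝ) ^ (-η)) := by
  have hsum : Summable fun n : ℕ => (n : ℝ) ^ (-η) := Real.summable_nat_rpow.2 (by linarith)
  have hYi : ∀ i, Integrable (Y i) P := fun i => integrable_of_abs_le (hY i) (hb i)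
  have hYY : ∀ i l, Integrable (fun ω => Y i ω * Y l ω) P := fun i l =>
    (hYi l).bdd_mul (hY i).aestronglyMeasurable (c := b) (Eventually.of_forall (hb i))
  induction q with
  | zero => simp
  | succ q ih =>
    set S : Ω → ℝ := fun ω => ∑ i ∈ Finset.range q, Y (k + i) ω with hS
    have hSm : Measurable S := Finset.measurable_fun_sum _ fun i _ => hY (k + i)
    have hSb : ∀ ω, |S ω| ≤ q * b := fun ω => by
      calc |S ω| ≤ ∑ i ∈ Finset.range q, |Y (k + i) ω| := Finset.abs_sum_le_sum_abs _ _
        _ ≤ ∑ i ∈ Finset.range q, b := Finset.sum_le_sum fun i _ => hb _ _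
        _ = q * b := by simp
    have hS2 : Integrable (fun ω => S ω ^ 2) P := by
      refine integrable_of_abs_le (b := (q * b) ^ 2) (hSm.pow_const 2) fun ω => ?_
      rw [abs_pow]
      exact pow_le_pow_left₀ (abs_nonneg _) (hSb ω) 2
    have hSY : ∀ ω, S ω * Y (k + q) ω = ∑ i ∈ Finset.range q, Y (k + i) ω * Y (k + q) ω :=
      fun ω => Finset.sum_mul _ _ _
    have hSYi : Integrable (fun ω => S ω * Y (k + q) ω) P := by
      simp only [hSY]
      exact integrable_finsetSum _ fun i _ => hYY _ _
    have hcross : ∫ ω, S ω * Y (k + q) ω ∂P ≤ c * ∑' n : ℕ, (n : ℝ) ^ (-η) := by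
      simp only [hSY]
      rw [integral_finsetSum _ fun i _ => hYY _ _]
      calc _ ≤ ∑ i ∈ Finset.range q, c * ((q - i : ℕ) : ℝ) ^ (-η) := by
            refine Finset.sum_le_sum fun i hi => ?_
            have hi' := Finset.mem_range.1 hi
            have := hcov (k + i) (k + q) (by omega)
            rw [show k + q - (k + i) = q - i by omega] at this
            exact (le_abs_self _).trans this
        _ = c * ∑ i ∈ Finset.range q, ((i + 1 : ℕ) : ℝ) ^ (-η) := by
            rw [← Finset.mul_sum, ← Finset.sum_range_reflect]
            congr 1
            refine Finset.sum_congr rfl fun i hi => ?_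
            have hi' := Finset.mem_range.1 hi
            rw [show q - (q - 1 - i) = i + 1 by omega]
        _ ≤ c * ∑' n : ℕ, (n : ℝ) ^ (-η) := by
            refine mul_le_mul_of_nonneg_left ?_ hc
            have := hsum.sum_le_tsum (Finset.range (q + 1)) fun n _ => by positivity
            rw [Finset.sum_range_succ'] at this
            have h0 : (0 : ℝ) ≤ ((0 : ℕ) : ℝ) ^ (-η) := by positivity
            linarith
    have hexp : ∀ ω, (∑ i ∈ Finset.range (q + 1), Y (k + i) ω) ^ 2 =
        S ω ^ 2 + 2 * (S ω * Y (k + q) ω) + Y (k + q) ω ^ 2 := fun ω => by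
      rw [Finset.sum_range_succ]; simp only [hS]; ring
    simp only [hexp]
    have hY2 : Integrable (fun ω => Y (k + q) ω ^ 2) P := by simpa [sq] using hYY (k + q) (k + q)
    have hA : Integrable (fun ω => S ω ^ 2 + 2 * (S ω * Y (k + q) ω)) P :=
      hS2.add (hSYi.const_mul 2)
    rw [integral_add hA hY2, integral_add hS2 (hSYi.const_mul 2), integral_const_mul]
    have := hv (k + q)
    push_cast
    linarith

end Covariance

/-! ### Maximal partial sums of a mixing sequence -/

section Blocks

theorem sum_range_eq_sum_blocks (f : ℕ → ℝ) (q l : ℕ) :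
    ∑ i ∈ Finset.range l, f i =
      ∑ k ∈ Finset.range (l / q), ∑ i ∈ Finset.range q, f (k * q + i) +
        ∑ i ∈ Finset.range (l % q), f (l / q * q + i) := by
  have h : ∀ κ, ∑ i ∈ Finset.range (κ * q), f i =
      ∑ k ∈ Finset.range κ, ∑ i ∈ Finset.range q, f (k * q + i) := by
    intro κ
    induction κ with
    | zero => simp
    | succ κ ih => rw [add_mul, one_mul, Finset.sum_range_add, ih, Finset.sum_range_succ]
  conv_lhs => rw [← Nat.div_add_mod' l q, Finset.sum_range_add, h]

theorem sum_range_eq_even_add_odd (f : ℕ → ℝ) (κ : ℕ) :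
    ∑ k ∈ Finset.range κ, f k =
      ∑ l ∈ Finset.range ((κ + 1) / 2), f (2 * l + 0) +
        ∑ l ∈ Finset.range (κ / 2), f (2 * l + 1) := by
  induction κ with
  | zero => simp
  | succ κ ih =>
    rw [Finset.sum_range_succ, ih]
    rcases Nat.even_or_odd' κ with ⟨r, rfl | rfl⟩
    · rw [show (2 * r + 1 + 1) / 2 = r + 1 by omega, show (2 * r + 1) / 2 = r by omega,
        show 2 * r / 2 = r by omega, Finset.sum_range_succ]
      simp only [add_zero]; ring
    · rw [show (2 * r + 1 + 1 + 1) / 2 = r + 1 by omega, show (2 * r + 1 + 1) / 2 = r + 1 by omega,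
        show (2 * r + 1) / 2 = r by omega, Finset.sum_range_succ (fun l => f (2 * l + 1))]
      ring

variable {Ω : Type*}

/-- The information available before the `l`-th of the blocks of length `q` and parity `e`. It is
trivial for the first of them. -/
@[reducible] def blockPast (past : ℕ → MeasurableSpace Ω) (q e : ℕ) : ℕ → MeasurableSpace Ω
  | 0 => ⊥
  | l + 1 => past ((2 * l + 1 + e) * q)

variable {mΩ : MeasurableSpace Ω} {P : Measure Ω} [IsProbabilityMeasure P]

/-- A Bernstein inequality for the maximal partial sum of a mixing sequence: blocks of length `q`
are separated into even and odd ones, `measure_exists_sum_ge_le` is applied to each family and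
each sign. -/
theorem measure_exists_abs_sum_gt_le {past fut : ℕ → MeasurableSpace Ω} {Y : ℕ → Ω → ℝ}
    {A β b V t y : ℝ} {q n : ℕ} (hpast : ∀ k, past k ≤ mΩ) (hfut : ∀ k, fut k ≤ mΩ)
    (hpm : Monotone past) (hfm : Antitone fut)
    (hYp : ∀ i, Measurable[past (i + 1)] (Y i)) (hYf : ∀ i, Measurable[fut i] (Y i))
    (hmix : ∀ k l, AlphaBound P (past k) (fut (k + l)) (A * ((l : ℝ) + 1) ^ (-β)))
    (hA : 0 ≤ A) (hβ : 0 ≤ β)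
    (hb : ∀ i ω, |Y i ω| ≤ b) (hmean : ∀ i, ∫ ω, Y i ω ∂P = 0) (hV0 : 0 ≤ V)
    (hV : ∀ k, ∫ ω, (∑ i ∈ Finset.range q, Y (k + i) ω) ^ 2 ∂P ≤ q * V)
    (hq : 1 ≤ q) (ht : 0 < t) (hy : 0 < y) (htb : t * (q * b) ≤ 1)
    (htV : t ^ 2 * (n * V) ≤ t * y / 4) :
    P.real {ω | ∃ l ≤ n, 2 * y + q * b < |∑ i ∈ Finset.range l, Y i ω|} ≤
      4 * ((((n / q : ℕ) : ℝ) + 1) * Real.exp (-(t * y / 2)) +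
        4 / (t * y) * ((n / q : ℕ) * (2 * Real.exp 1 * (A * (q : ℝ) ^ (-β))))) := by
  have hq0 : (0 : ℝ) < q := by exact_mod_cast hq
  have hYm : ∀ i, Measurable (Y i) := fun i => (hYf i).mono (hfut i) le_rfl
  have hYi : ∀ i, Integrable (Y i) P := fun i => integrable_of_abs_le (hYm i) (hb i)
  have hb0 : 0 ≤ b := by
    obtain ⟨ω⟩ := P.nonempty_of_neZero
    exact (abs_nonneg _).trans (hb 0 ω)
  set bl : ℕ → Ω → ℝ := fun k ω => ∑ i ∈ Finset.range q, Y (k * q + i) ω with hbl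
  have hblb : ∀ k ω, |bl k ω| ≤ q * b := fun k ω => by
    calc |bl k ω| ≤ ∑ i ∈ Finset.range q, |Y (k * q + i) ω| := Finset.abs_sum_le_sum_abs _ _
      _ ≤ ∑ i ∈ Finset.range q, b := Finset.sum_le_sum fun i _ => hb _ _
      _ = q * b := by simp
  have hblp : ∀ k, Measurable[past ((k + 1) * q)] (bl k) := fun k =>
    Finset.measurable_fun_sum _ fun i hi => (hYp _).mono (hpm (by
      have := Finset.mem_range.1 hi
      rw [add_mul]; omega)) le_rfl
  have hblf : ∀ k, Measurable[fut (k * q)] (bl k) := fun k =>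
    Finset.measurable_fun_sum _ fun i _ => (hYf _).mono (hfm (Nat.le_add_right _ _)) le_rfl
  have hblmean : ∀ k, ∫ ω, bl k ω ∂P = 0 := fun k => by
    simp only [hbl]
    rw [integral_finsetSum _ fun i _ => hYi _]
    exact Finset.sum_eq_zero fun i _ => hmean _
  set ρ : ℝ := A * (q : ℝ) ^ (-β) with hρ
  have hρ0 : 0 ≤ ρ := by positivity
  -- Blocks of the same parity `e` are separated by gaps of length `q`; `σ` is a sign.
  have hone : ∀ (e : ℕ) (σ : ℝ), |σ| = 1 →
      P.real {ω | ∃ l ≤ n / q, t * y ≤ ∑ k ∈ Finset.range l, σ * t * bl (2 * k + e) ω} ≤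
        (((n / q : ℕ) : ℝ) + 1) * Real.exp (-(t * y / 2)) +
          4 / (t * y) * ((n / q : ℕ) * (2 * Real.exp 1 * ρ)) := by
    intro e σ hσ
    have hσ2 : σ ^ 2 = 1 := by rw [← sq_abs, hσ]; norm_num
    refine measure_exists_sum_ge_le (𝓕 := blockPast past q e)
      (𝓖 := fun k => fut ((2 * k + e) * q)) (v := t ^ 2 * (q * V)) ?_ (fun k => hfut _) ?_ ?_ ?_
      ?_ ?_ ?_ ?_ (mul_pos ht hy) ?_
    · rintro (_ | k)
      · exact bot_le
      · exact hpast _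
    · refine monotone_nat_of_le_succ ?_
      rintro (_ | k)
      · exact bot_le
      · exact hpm (Nat.mul_le_mul_right _ (by omega))
    · intro k
      refine Measurable.const_mul ?_ _
      have := hblp (2 * k + e)
      rwa [show 2 * k + e + 1 = 2 * k + 1 + e by ring] at this
    · intro k
      exact (hblf _).const_mul _
    · rintro (_ | k)
      · exact AlphaBound.bot_left hρ0
      · have h1 := hmix ((2 * k + 1 + e) * q) q
        have h2 : (2 * (k + 1) + e) * q = (2 * k + 1 + e) * q + q := by ring
        simp only [blockPast]
        rw [h2]
        refine h1.mono_const (mul_le_mul_of_nonneg_left ?_ hA)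
        exact Real.rpow_le_rpow_of_nonpos hq0 (by linarith) (by linarith)
    · intro k ω
      rw [abs_mul, abs_mul, hσ, one_mul, abs_of_pos ht]
      exact (mul_le_mul_of_nonneg_left (hblb _ _) ht.le).trans htb
    · intro k
      rw [integral_const_mul, hblmean, mul_zero]
    · intro k
      have : ∀ ω, (σ * t * bl (2 * k + e) ω) ^ 2 = t ^ 2 * bl (2 * k + e) ω ^ 2 := fun ω => by
        rw [mul_pow, mul_pow, hσ2, one_mul]
      simp only [this]
      rw [integral_const_mul]
      exact mul_le_mul_of_nonneg_left (hV _) (by positivity)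
    · refine le_trans ?_ htV
      have : ((n / q : ℕ) : ℝ) * q ≤ n := by exact_mod_cast Nat.div_mul_le_self n q
      calc ((n / q : ℕ) : ℝ) * (t ^ 2 * (q * V)) = t ^ 2 * (((n / q : ℕ) : ℝ) * q * V) := by ring
        _ ≤ _ := by gcongr
  set Ev : ℕ → ℝ → Set Ω := fun e σ =>
    {ω | ∃ l ≤ n / q, t * y ≤ ∑ k ∈ Finset.range l, σ * t * bl (2 * k + e) ω} with hEv
  have hsub : {ω | ∃ l ≤ n, 2 * y + q * b < |∑ i ∈ Finset.range l, Y i ω|} ⊆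
      (Ev 0 1 ∪ Ev 0 (-1)) ∪ (Ev 1 1 ∪ Ev 1 (-1)) := by
    rintro ω ⟨l, hl, hlt⟩
    have hκ : l / q ≤ n / q := Nat.div_le_div_right hl
    rw [sum_range_eq_sum_blocks (fun i => Y i ω) q l,
      sum_range_eq_even_add_odd (fun k => ∑ i ∈ Finset.range q, Y (k * q + i) ω)] at hlt
    have hrem : |∑ i ∈ Finset.range (l % q), Y (l / q * q + i) ω| ≤ q * b := by
      calc _ ≤ ∑ i ∈ Finset.range (l % q), |Y (l / q * q + i) ω| := Finset.abs_sum_le_sum_abs _ _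
        _ ≤ ∑ i ∈ Finset.range (l % q), b := Finset.sum_le_sum fun i _ => hb _ _
        _ = (l % q : ℕ) * b := by simp
        _ ≤ q * b := by
            refine mul_le_mul_of_nonneg_right ?_ hb0
            exact_mod_cast (Nat.mod_lt l hq).le
    have hcase : ∀ e l', l' ≤ n / q → y ≤ |∑ k ∈ Finset.range l', bl (2 * k + e) ω| →
        ω ∈ Ev e 1 ∪ Ev e (-1) := by
      intro e l' hl' hle
      rcases le_abs.1 hle with h | h
      · refine Or.inl ⟨l', hl', ?_⟩
        rw [← Finset.mul_sum, one_mul]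
        exact mul_le_mul_of_nonneg_left h ht.le
      · refine Or.inr ⟨l', hl', ?_⟩
        rw [← Finset.mul_sum]
        have := mul_le_mul_of_nonneg_left h ht.le
        linarith
    by_cases h0 : y ≤ |∑ k ∈ Finset.range ((l / q + 1) / 2), bl (2 * k + 0) ω|
    · exact Or.inl (hcase 0 _ (le_trans (by lia) hκ) h0)
    by_cases h1 : y ≤ |∑ k ∈ Finset.range (l / q / 2), bl (2 * k + 1) ω|
    · exact Or.inr (hcase 1 _ (le_trans (Nat.div_le_self _ _) hκ) h1)
    exfalso
    have a1 := abs_add_le (∑ k ∈ Finset.range ((l / q + 1) / 2), bl (2 * k + 0) ω +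
      ∑ k ∈ Finset.range (l / q / 2), bl (2 * k + 1) ω)
      (∑ i ∈ Finset.range (l % q), Y (l / q * q + i) ω)
    have a2 := abs_add_le (∑ k ∈ Finset.range ((l / q + 1) / 2), bl (2 * k + 0) ω)
      (∑ k ∈ Finset.range (l / q / 2), bl (2 * k + 1) ω)
    simp only [hbl] at a1 a2 h0 h1
    linarith [not_le.1 h0, not_le.1 h1]
  have := (measureReal_mono (μ := P) hsub).trans ((measureReal_union_le _ _).trans
    (add_le_add (measureReal_union_le _ _) (measureReal_union_le _ _)))
  have e1 := hone 0 1 (by simp)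
  have e2 := hone 0 (-1) (by simp)
  have e3 := hone 1 1 (by simp)
  have e4 := hone 1 (-1) (by simp)
  simp only [hEv] at this
  linarith

end Blocks

/-! ### Rows of a triangular array -/

section Rows

variable {Ω : Type*} {mΩ : MeasurableSpace Ω} {P : Measure Ω} {X : ℕ → Ω → ℝ}
  {A β s τ μ : ℝ} {T : ℕ}

theorem rowSigma_le {i k : ℕ} (h : ∀ l ∈ Set.Icc i k, Measurable (X l)) : rowSigma X i k ≤ mΩ :=
  iSup₂_le fun l hl => (h l hl).comap_le

theorem measurable_rowSigma {i k l : ℕ} (hl : l ∈ Set.Icc i k) : Measurable[rowSigma X i k] (X l) :=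
  (comap_measurable (X l)).mono
    (le_iSup₂ (f := fun l _ => MeasurableSpace.comap (X l) (borel ℝ)) l hl) le_rfl

theorem rowSigma_mono {i k i' k' : ℕ} (h : Set.Icc i k ⊆ Set.Icc i' k') :
    rowSigma X i k ≤ rowSigma X i' k' := biSup_mono fun _ hl => h hl

theorem rowSigma_of_lt {i k : ℕ} (h : k < i) : rowSigma X i k = ⊥ := by
  simp [rowSigma, Set.Icc_eq_empty_of_lt h]

/-- The centred truncation at level `τ` of the `i`-th entry of a row of length `T`, continued by
zero outside the row. -/
noncomputable def centredClamp (P : Measure Ω) (X : ℕ → Ω → ℝ) (T : ℕ) (τ : ℝ) (i : ℕ)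
    (ω : Ω) : ℝ :=
  if 1 ≤ i ∧ i ≤ T then clamp τ (X i ω) - ∫ ω', clamp τ (X i ω') ∂P else 0

variable [IsProbabilityMeasure P]

/-- The gap between the indices `u + k` and `u + k + l + 1` is `l + 1`. The minimum with `T` keeps
the first σ-algebra inside the row. -/
theorem alphaBound_rowSigma (hA : 0 ≤ A)
    (hmix : ∀ i : ℕ, 1 ≤ i → alphaCoeff P X T i ≤ A * (i : ℝ) ^ (-β)) (u k l : ℕ) :
    AlphaBound P (rowSigma X 1 (min (u + k) T)) (rowSigma X (u + (k + l) + 1) T)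
      (A * ((l : ℝ) + 1) ^ (-β)) := by
  have h0 : 0 ≤ A * ((l : ℝ) + 1) ^ (-β) := by positivity
  rcases Nat.lt_or_ge T (u + (k + l) + 1) with hT | hT
  · rw [rowSigma_of_lt hT]; exact AlphaBound.bot_right h0
  rcases Nat.eq_zero_or_pos (u + k) with hk | hk
  · rw [rowSigma_of_lt (i := 1) (k := min (u + k) T) (by omega)]; exact AlphaBound.bot_left h0
  have h1 := hmix (l + 1) (by omega)
  rw [min_eq_left (by omega)]
  intro B C hB hC
  refine le_trans ?_ (h1.trans_eq (by push_cast; rfl))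
  rw [alphaCoeff, if_neg (by omega), if_neg (by omega)]
  refine le_csSup (alphaCoeff_bddAbove P X T (l + 1)) ⟨u + k, hk, by omega, B, C, hC, ?_, rfl⟩
  rwa [show u + k + (l + 1) = u + (k + l) + 1 by ring]

theorem abs_centredClamp_le (hτ : 0 ≤ τ) (i : ℕ) (ω : Ω) :
    |centredClamp P X T τ i ω| ≤ 2 * τ := by
  unfold centredClamp
  split_ifs with h
  · have h1 : |∫ ω', clamp τ (X i ω') ∂P| ≤ τ := by
      have := norm_integral_le_of_norm_le_const (μ := P) (f := fun ω' => clamp τ (X i ω'))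
        (C := τ) (Eventually.of_forall fun ω' => abs_clamp_le hτ _)
      simpa using this
    calc _ ≤ |clamp τ (X i ω)| + |∫ ω', clamp τ (X i ω') ∂P| := abs_sub _ _
      _ ≤ 2 * τ := by linarith [abs_clamp_le hτ (X i ω)]
  · simpa using hτ

theorem integral_centred_mul_centred {U V : Ω → ℝ} (hU : Integrable U P) (hV : Integrable V P)
    (hUV : Integrable (fun ω => U ω * V ω) P) :
    ∫ ω, (U ω - ∫ ω', U ω' ∂P) * (V ω - ∫ ω', V ω' ∂P) ∂P =
      ∫ ω, U ω * V ω ∂P - (∫ ω, U ω ∂P) * ∫ ω, V ω ∂P := by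
  set a := ∫ ω', U ω' ∂P with ha
  set b := ∫ ω', V ω' ∂P with hb
  have h1 : ∀ ω, (U ω - a) * (V ω - b) = U ω * V ω - a * V ω - (b * U ω - a * b) := fun ω => by
    ring
  simp only [h1]
  have hI : Integrable (fun ω => U ω * V ω - a * V ω) P := hUV.sub (hV.const_mul a)
  have hJ : Integrable (fun ω => b * U ω - a * b) P := (hU.const_mul b).sub (integrable_const _)
  rw [integral_sub hI hJ, integral_sub hUV (hV.const_mul a),
    integral_sub (hU.const_mul b) (integrable_const _), integral_const_mul, integral_const_mul,
    ← ha, ← hb]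
  simp; ring

/-- The constant in the bound for the second moments of block sums of a mixing row: `A` and `β`
describe the mixing rate, `s` is the number of moments. -/
noncomputable def blockConst (A β s : ℝ) : ℝ :=
  2 + 2 * (4 * A + 8) * ∑' n : ℕ, (n : ℝ) ^ (-(β * (s - 2) / s))

theorem blockConst_pos (hA : 0 ≤ A) : 0 < blockConst A β s := by
  have : 0 ≤ ∑' n : ℕ, (n : ℝ) ^ (-(β * (s - 2) / s)) := tsum_nonneg fun n => by positivity
  unfold blockConst; positivity

/-- The maximal partial sum of the centred truncations over a window `u + 1, …, u + n` of a mixing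
row. -/
theorem measure_exists_abs_sum_centredClamp_gt_le
    (hX : ∀ i, 1 ≤ i → i ≤ T → Measurable (X i)) (hA : 0 ≤ A) (hβ : 0 ≤ β) (hs : 2 < s)
    (hη : s < β * (s - 2))
    (hmix : ∀ i : ℕ, 1 ≤ i → alphaCoeff P X T i ≤ A * (i : ℝ) ^ (-β))
    (hτ : 0 < τ) (hμ : 1 ≤ μ)
    (hmom : ∀ i, 1 ≤ i → i ≤ T → ∫ ω, |clamp τ (X i ω)| ^ s ∂P ≤ μ)
    {u n q : ℕ} {t y : ℝ} (hq : 1 ≤ q) (ht : 0 < t) (hy : 0 < y) (htb : t * (q * (2 * τ)) ≤ 1)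
    (htV : t ^ 2 * (n * (blockConst A β s * μ ^ 2)) ≤ t * y / 4) :
    P.real {ω | ∃ l ≤ n, 2 * y + q * (2 * τ) <
        |∑ i ∈ Finset.range l, centredClamp P X T τ (u + 1 + i) ω|} ≤
      4 * ((((n / q : ℕ) : ℝ) + 1) * Real.exp (-(t * y / 2)) +
        4 / (t * y) * ((n / q : ℕ) * (2 * Real.exp 1 * (A * (q : ℝ) ^ (-β))))) := by
  set past : ℕ → MeasurableSpace Ω := fun k => rowSigma X 1 (min (u + k) T) with hpast
  set fut : ℕ → MeasurableSpace Ω := fun k => rowSigma X (u + k + 1) T with hfut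
  have hpastle : ∀ k, past k ≤ mΩ := fun k =>
    rowSigma_le fun l hl => hX l hl.1 (hl.2.trans (min_le_right _ _))
  have hfutle : ∀ k, fut k ≤ mΩ := fun k =>
    rowSigma_le fun l hl => hX l (by have := hl.1; omega) hl.2
  have hZm : ∀ i, 1 ≤ i → i ≤ T → Measurable fun ω => clamp τ (X i ω) := fun i h1 h2 =>
    (measurable_clamp τ).comp (hX i h1 h2)
  have hZb : ∀ i ω, |clamp τ (X i ω)| ≤ τ := fun i ω => abs_clamp_le hτ.le _
  have hZi : ∀ i, 1 ≤ i → i ≤ T → Integrable (fun ω => clamp τ (X i ω)) P := fun i h1 h2 =>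
    integrable_of_abs_le (hZm i h1 h2) (hZb i)
  have hZp : ∀ i, u + 1 + i ≤ T → Measurable[past (i + 1)] fun ω => clamp τ (X (u + 1 + i) ω) :=
    fun i hi => (measurable_clamp τ).comp
      (measurable_rowSigma ⟨by omega, le_min (by omega) hi⟩)
  have hZf : ∀ i, u + 1 + i ≤ T → Measurable[fut i] fun ω => clamp τ (X (u + 1 + i) ω) :=
    fun i hi => (measurable_clamp τ).comp (measurable_rowSigma ⟨by omega, hi⟩)
  set Y : ℕ → Ω → ℝ := fun i => centredClamp P X T τ (u + 1 + i) with hY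
  have hYin : ∀ i, u + 1 + i ≤ T → Y i = fun ω => clamp τ (X (u + 1 + i) ω) -
      ∫ ω', clamp τ (X (u + 1 + i) ω') ∂P := fun i hi => by
    ext ω; simp only [hY, centredClamp]; rw [if_pos ⟨by omega, hi⟩]
  have hYout : ∀ i, ¬ u + 1 + i ≤ T → Y i = fun _ => 0 := fun i hi => by
    ext ω; simp only [hY, centredClamp]; rw [if_neg (by tauto)]
  have hYp : ∀ i, Measurable[past (i + 1)] (Y i) := fun i => by
    by_cases hi : u + 1 + i ≤ T
    · rw [hYin i hi]; exact (hZp i hi).sub_const _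
    · rw [hYout i hi]; exact measurable_const
  have hYf : ∀ i, Measurable[fut i] (Y i) := fun i => by
    by_cases hi : u + 1 + i ≤ T
    · rw [hYin i hi]; exact (hZf i hi).sub_const _
    · rw [hYout i hi]; exact measurable_const
  have hmixA : ∀ k l, AlphaBound P (past k) (fut (k + l)) (A * ((l : ℝ) + 1) ^ (-β)) := fun k l =>
    alphaBound_rowSigma hA hmix u k l
  have hYb : ∀ i ω, |Y i ω| ≤ 2 * τ := fun i ω => abs_centredClamp_le hτ.le _ ω
  have hYm : ∀ i, Measurable (Y i) := fun i => (hYf i).mono (hfutle i) le_rfl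
  have hmean : ∀ i, ∫ ω, Y i ω ∂P = 0 := fun i => by
    by_cases hi : u + 1 + i ≤ T
    · rw [hYin i hi, integral_sub (hZi _ (by omega) hi) (integrable_const _)]; simp
    · rw [hYout i hi]; simp
  have hs0 : 0 < s := by linarith
  have hη1 : 1 < β * (s - 2) / s := by rwa [one_lt_div hs0]
  have hZZ : ∀ i l, u + 1 + i ≤ T → u + 1 + l ≤ T →
      Integrable (fun ω => clamp τ (X (u + 1 + i) ω) * clamp τ (X (u + 1 + l) ω)) P :=
    fun i l hi hl => (hZi _ (by omega) hl).bdd_mul (hZm _ (by omega) hi).aestronglyMeasurable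
      (c := τ) (Eventually.of_forall (hZb _))
  have hvar : ∀ i, ∫ ω, Y i ω ^ 2 ∂P ≤ 2 * μ := fun i => by
    by_cases hi : u + 1 + i ≤ T
    · have h1 : 1 ≤ u + 1 + i := by omega
      have h2 := integral_centred_mul_centred (hZi _ h1 hi) (hZi _ h1 hi) (hZZ i i hi hi)
      have h3 : Integrable (fun ω => |clamp τ (X (u + 1 + i) ω)| ^ s) P :=
        integrable_rpow_of_abs_le (hZm _ h1 hi) hs0.le (hZb _)
      have h4 : ∫ ω, clamp τ (X (u + 1 + i) ω) * clamp τ (X (u + 1 + i) ω) ∂P ≤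
          ∫ ω, (1 + |clamp τ (X (u + 1 + i) ω)| ^ s) ∂P :=
        integral_mono (hZZ i i hi hi) ((integrable_const _).add h3) fun ω => by
          have := sq_le_one_add_rpow hs.le (clamp τ (X (u + 1 + i) ω))
          simpa [sq] using this
      rw [integral_add (integrable_const _) h3] at h4
      simp only [integral_const, probReal_univ, smul_eq_mul, mul_one] at h4
      rw [hYin i hi]
      simp only [sq]
      rw [h2]
      nlinarith [hmom _ h1 hi, mul_self_nonneg (∫ ω, clamp τ (X (u + 1 + i) ω) ∂P)]
    · rw [hYout i hi]; simp; linarith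
  have hcov : ∀ i l, i < l → |∫ ω, Y i ω * Y l ω ∂P| ≤
      (4 * A + 8) * μ ^ 2 * ((l - i : ℕ) : ℝ) ^ (-(β * (s - 2) / s)) := by
    intro i l hil
    by_cases hl : u + 1 + l ≤ T
    · have hi : u + 1 + i ≤ T := by omega
      rw [hYin i hi, hYin l hl, integral_centred_mul_centred (hZi _ (by omega) hi)
        (hZi _ (by omega) hl) (hZZ i l hi hl)]
      have hm := hmixA (i + 1) (l - i - 1)
      rw [show i + 1 + (l - i - 1) = l by omega,
        show (((l - i - 1 : ℕ) : ℝ) + 1) = ((l - i : ℕ) : ℝ) by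
          rw [← Nat.cast_succ]; congr 1; omega] at hm
      set d : ℝ := ((l - i : ℕ) : ℝ) with hd
      have hd1 : 1 ≤ d := by rw [hd]; exact_mod_cast (by omega : 1 ≤ l - i)
      have hd0 : 0 < d := by linarith
      have hu1 : 1 ≤ d ^ (β / s) := Real.one_le_rpow hd1 (by positivity)
      refine (hm.abs_cov_le_of_moment (hpastle _) (hfutle _) (hZp i hi) (hZf l hl)
        (hZb _) (hZb _) hs.le hμ (hmom _ (by omega) hi) (hmom _ (by omega) hl) hu1).trans ?_
      -- The truncation level `d ^ (β / s)` balances the two terms.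
      have e1 : A * d ^ (-β) * (d ^ (β / s)) ^ 2 = A * d ^ (-(β * (s - 2) / s)) := by
        rw [← Real.rpow_natCast, ← Real.rpow_mul hd0.le, mul_assoc, ← Real.rpow_add hd0]
        congr 2; push_cast; field_simp; ring
      have e2 : (d ^ (β / s)) ^ (2 - s) = d ^ (-(β * (s - 2) / s)) := by
        rw [← Real.rpow_mul hd0.le]; congr 1; field_simp; ring
      rw [mul_assoc 4, e1, e2]
      have hp : 0 ≤ A * d ^ (-(β * (s - 2) / s)) := by positivity
      have hμ2 : 1 ≤ μ ^ 2 := one_le_pow₀ hμ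
      nlinarith
    · rw [hYout l hl]; simp; positivity
  have hV := integral_sq_sum_le (P := P) (v := 2 * μ) hη1 hYm hYb (by positivity) hvar hcov
  have hVle : ∀ k, ∫ ω, (∑ i ∈ Finset.range q, Y (k + i) ω) ^ 2 ∂P ≤
      q * (blockConst A β s * μ ^ 2) := fun k => by
    refine (hV k q).trans (mul_le_mul_of_nonneg_left ?_ (Nat.cast_nonneg _))
    unfold blockConst
    nlinarith
  exact measure_exists_abs_sum_gt_le hpastle hfutle
    (fun a b hab => rowSigma_mono (Set.Icc_subset_Icc_right (min_le_min_right _ (by omega))))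
    (fun a b hab => rowSigma_mono (Set.Icc_subset_Icc_left (by omega)))
    hYp hYf hmixA hA hβ hYb hmean (mul_nonneg (blockConst_pos hA).le (sq_nonneg _)) hVle hq ht hy
    htb htV

end Rows

/-! ### Kernel sums and nets -/

section Deterministic

/-- Abel summation: a weighted sum is controlled by the partial sums and the variation of the
weights. -/
theorem abs_sum_mul_le_of_partialSums {f Y : ℕ → ℝ} {n : ℕ} {W V M : ℝ} (hW : ∀ i, |f i| ≤ W)
    (hV : ∀ i, |f (i + 1) - f i| ≤ V)
    (hM : ∀ l ≤ n, |∑ i ∈ Finset.range l, Y i| ≤ M) :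
    |∑ i ∈ Finset.range n, f i * Y i| ≤ (W + n * V) * M := by
  have hW0 : 0 ≤ W := (abs_nonneg _).trans (hW 0)
  have hV0 : 0 ≤ V := (abs_nonneg _).trans (hV 0)
  have hM0 : 0 ≤ M := (abs_nonneg _).trans (hM 0 (Nat.zero_le _))
  have h := Finset.sum_range_by_parts f Y n
  simp only [smul_eq_mul] at h
  rw [h]
  have h1 : |f (n - 1) * ∑ i ∈ Finset.range n, Y i| ≤ W * M := by
    rw [abs_mul]
    exact mul_le_mul (hW _) (hM n le_rfl) (abs_nonneg _) hW0
  have h2 : |∑ i ∈ Finset.range (n - 1), (f (i + 1) - f i) * ∑ i ∈ Finset.range (i + 1), Y i| ≤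
      n * V * M := by
    calc _ ≤ ∑ i ∈ Finset.range (n - 1), |(f (i + 1) - f i) * ∑ i ∈ Finset.range (i + 1), Y i| :=
          Finset.abs_sum_le_sum_abs _ _
      _ ≤ ∑ i ∈ Finset.range (n - 1), V * M := by
          refine Finset.sum_le_sum fun i hi => ?_
          have hi' := Finset.mem_range.1 hi
          rw [abs_mul]
          exact mul_le_mul (hV i) (hM _ (by omega)) (abs_nonneg _) hV0
      _ = ((n - 1 : ℕ) : ℝ) * (V * M) := by simp
      _ ≤ n * (V * M) := by
          refine mul_le_mul_of_nonneg_right ?_ (by positivity)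
          exact_mod_cast Nat.sub_le _ _
      _ = n * V * M := by ring
  exact (abs_sub _ _).trans (by linarith)

/-- A kernel sum over a row is controlled, simultaneously for all `x ∈ [0, 1]`, by partial sums
over windows of length `3 * w` that start at multiples of `w`, where `w` is slightly larger than
half the length of the support of the kernel. -/
theorem abs_kernel_sum_le {g : ℝ → ℝ} {W Lam L h x M : ℝ} {T w : ℕ} {Y : ℕ → ℝ}
    (hgW : ∀ u, |g u| ≤ W) (hgL : ∀ u u', |g u - g u'| ≤ Lam * |u - u'|)
    (hgs : ∀ u, L < |u| → g u = 0) (hT : 1 ≤ T) (hh : 0 < h)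
    (hx : x ∈ Set.Icc (0 : ℝ) 1) (hw : L * (T * h) < w) (hw0 : 1 ≤ w)
    (hY : ∀ i, T < i → Y i = 0)
    (hM : ∀ v ≤ T / w, ∀ l ≤ 3 * w, |∑ i ∈ Finset.range l, Y (w * v + 1 + i)| ≤ M) :
    |∑ i ∈ Finset.Icc 1 T, Y i * g (((i : ℝ) / T - x) / h)| ≤
      (W + (3 * w : ℕ) * (Lam / (T * h))) * M := by
  have hT0 : (0 : ℝ) < T := by exact_mod_cast hT
  have hw0' : (0 : ℝ) < w := by exact_mod_cast hw0
  set v₀ : ℕ := ⌊x * T / w⌋₊ with hv₀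
  set v := v₀ - 1 with hv
  have hlow : (w : ℝ) * v₀ ≤ x * T := by
    have := Nat.floor_le (div_nonneg (mul_nonneg hx.1 hT0.le) hw0'.le)
    rw [le_div_iff₀ hw0'] at this
    linarith
  have hup : x * T < w * (v₀ + 1) := by
    have := Nat.lt_floor_add_one (x * T / w)
    rw [div_lt_iff₀ hw0'] at this
    linarith
  have hvT : v ≤ T / w := by
    rw [Nat.le_div_iff_mul_le (by omega)]
    have h1 : (w : ℝ) * v₀ ≤ T := hlow.trans (mul_le_of_le_one_left hT0.le hx.2)
    have h2 : w * v₀ ≤ T := by exact_mod_cast h1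
    calc v * w ≤ v₀ * w := Nat.mul_le_mul_right _ (Nat.sub_le _ _)
      _ ≤ T := by rw [mul_comm]; exact h2
  set f : ℕ → ℝ := fun i => g (((i : ℝ) / T - x) / h) with hf
  have hsupp : ∀ i, 1 ≤ i → f i ≠ 0 → i ∈ Finset.Ico (w * v + 1) (w * v + 1 + 3 * w) := by
    intro i hi hne
    have h1 : |((i : ℝ) / T - x) / h| ≤ L := by
      by_contra! hlt
      exact hne (hgs _ hlt)
    rw [abs_div, abs_of_pos hh, div_le_iff₀ hh] at h1
    have h2 : |(i : ℝ) - x * T| < w := by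
      have : (i : ℝ) - x * T = ((i : ℝ) / T - x) * T := by field_simp
      rw [this, abs_mul, abs_of_pos hT0]
      nlinarith
    obtain ⟨h3, h4⟩ := abs_lt.1 h2
    rw [Finset.mem_Ico]
    constructor
    · rcases Nat.eq_zero_or_pos v₀ with h0 | h0
      · rw [hv, h0]; simpa using hi
      · have h5 : (v : ℝ) = v₀ - 1 := by rw [hv, Nat.cast_sub h0]; simp
        have h6 : (w : ℝ) * v < i := by rw [h5]; linarith
        have : w * v < i := by exact_mod_cast h6
        omega
    · have h5 : (v₀ : ℝ) ≤ v + 1 := by exact_mod_cast (by omega : v₀ ≤ v + 1)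
      have h6 : (i : ℝ) < w * v + 3 * w := by nlinarith
      have : i < w * v + 3 * w := by exact_mod_cast h6
      omega
  have hsum : ∑ i ∈ Finset.Icc 1 T, Y i * f i =
      ∑ i ∈ Finset.range (3 * w), f (w * v + 1 + i) * Y (w * v + 1 + i) := by
    have e1 : ∑ i ∈ Finset.Icc 1 T ∩ Finset.Ico (w * v + 1) (w * v + 1 + 3 * w), Y i * f i =
        ∑ i ∈ Finset.Icc 1 T, Y i * f i :=
      Finset.sum_subset Finset.inter_subset_left fun i hi hni => by
        by_contra hne
        exact hni (Finset.mem_inter.2 ⟨hi, hsupp i (Finset.mem_Icc.1 hi).1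
          (right_ne_zero_of_mul hne)⟩)
    have e2 : ∑ i ∈ Finset.Icc 1 T ∩ Finset.Ico (w * v + 1) (w * v + 1 + 3 * w), Y i * f i =
        ∑ i ∈ Finset.Ico (w * v + 1) (w * v + 1 + 3 * w), Y i * f i :=
      Finset.sum_subset Finset.inter_subset_right fun i hi hni => by
        have hi' := Finset.mem_Ico.1 hi
        have : T < i := by
          by_contra! hle
          exact hni (Finset.mem_inter.2 ⟨Finset.mem_Icc.2 ⟨by omega, hle⟩, hi⟩)
        rw [hY i this, zero_mul]
    rw [← e1, e2, Finset.sum_Ico_eq_sum_range]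
    simp only [Nat.add_sub_cancel_left, mul_comm (Y _)]
  rw [hsum]
  refine abs_sum_mul_le_of_partialSums (f := fun i => f (w * v + 1 + i))
    (Y := fun i => Y (w * v + 1 + i)) (fun i => hgW _) (fun i => ?_) (hM v hvT)
  refine (hgL _ _).trans_eq ?_
  have : ((((w * v + 1 + (i + 1) : ℕ) : ℝ) / T - x) / h - (((w * v + 1 + i : ℕ) : ℝ) / T - x) / h) =
      1 / (T * h) := by push_cast; field_simp; ring
  rw [this, abs_of_pos (by positivity)]
  ring

/-- The kernel `u ↦ K u * u ^ j` is again bounded, Lipschitz and compactly supported. -/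
theorem IsKernel.exists_bounds {K : ℝ → ℝ} (hK : IsKernel K) (j : ℕ) :
    ∃ W L Lam : ℝ, 1 ≤ W ∧ 1 ≤ L ∧ 0 ≤ Lam ∧ (∀ u, |K u * u ^ j| ≤ W) ∧
      (∀ u u', |K u * u ^ j - K u' * u' ^ j| ≤ Lam * |u - u'|) ∧
      ∀ u, L < |u| → K u * u ^ j = 0 := by
  obtain ⟨Kbar, hKbar⟩ := hK.bounded
  obtain ⟨L, hL, hsupp⟩ := hK.support
  obtain ⟨Lam, hLam, hlip⟩ := hK.lipschitz
  have hK0 : 0 ≤ Kbar := (abs_nonneg _).trans (hKbar 0)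
  have hL0 : 0 ≤ L := by linarith
  -- One of the points lies in the support; the powers are only compared if both do.
  have hmain : ∀ u u', |u| ≤ L → |K u * u ^ j - K u' * u' ^ j| ≤
      (Lam * L ^ j + Kbar * (j * L ^ (j - 1))) * |u - u'| := by
    intro u u' hu
    have hpu : |u ^ j| ≤ L ^ j := by
      rw [abs_pow]; exact pow_le_pow_left₀ (abs_nonneg _) hu j
    have h1 : |(K u - K u') * u ^ j| ≤ Lam * |u - u'| * L ^ j := by
      rw [abs_mul]
      exact mul_le_mul (hlip u u') hpu (abs_nonneg _) (by positivity)
    have h2 : |K u' * (u ^ j - u' ^ j)| ≤ Kbar * (|u - u'| * j * L ^ (j - 1)) := by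
      rw [abs_mul]
      by_cases hu' : |u'| ≤ L
      · refine mul_le_mul (hKbar u') ((abs_pow_sub_pow_le u u' j).trans ?_) (abs_nonneg _) hK0
        gcongr
        exact max_le hu hu'
      · rw [hsupp u' (not_le.1 hu'), abs_zero, zero_mul]; positivity
    calc |K u * u ^ j - K u' * u' ^ j| = |(K u - K u') * u ^ j + K u' * (u ^ j - u' ^ j)| := by
          congr 1; ring
      _ ≤ _ := (abs_add_le _ _).trans (add_le_add h1 h2)
      _ = _ := by ring
  refine ⟨Kbar * L ^ j + 1, L, Lam * L ^ j + Kbar * (j * L ^ (j - 1)), ?_, hL, by positivity,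
    fun u => ?_, fun u u' => ?_, fun u hu => by rw [hsupp u hu, zero_mul]⟩
  · have : 0 ≤ Kbar * L ^ j := by positivity
    linarith
  · by_cases hu : |u| ≤ L
    · rw [abs_mul, abs_pow]
      have : |K u| * |u| ^ j ≤ Kbar * L ^ j :=
        mul_le_mul (hKbar u) (pow_le_pow_left₀ (abs_nonneg _) hu j) (by positivity) hK0
      linarith
    · rw [hsupp u (not_le.1 hu), zero_mul, abs_zero]; positivity
  · by_cases hu : |u| ≤ L
    · exact hmain u u' hu
    by_cases hu' : |u'| ≤ L
    · rw [abs_sub_comm, abs_sub_comm u]; exact hmain u' u hu'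
    · rw [hsupp u (not_le.1 hu), hsupp u' (not_le.1 hu')]; simp; positivity

/-- A bounded set in `ℝ^m` has a `δ`-net of polynomial size that consists of its own points: one
from each non-empty cell of a grid of cubes. -/
theorem exists_finset_net {m : ℕ} {S : Set (Param m)} {d δ : ℝ} (hd : 1 ≤ d) (hδ : 0 < δ)
    (hδ1 : δ ≤ 1) (hS : ∀ γ ∈ S, ‖γ‖ ≤ d) :
    ∃ G : Finset (Param m), (∀ g ∈ G, g ∈ S) ∧ (∀ γ ∈ S, ∃ g ∈ G, ‖γ - g‖ ≤ δ) ∧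
      (G.card : ℝ) ≤ ((2 * m + 5) * d / δ) ^ m := by
  classical
  set η : ℝ := δ / (m + 1) with hη
  have hη0 : 0 < η := by positivity
  set N : ℕ := ⌈d / η⌉₊ with hN
  set φ : Param m → Fin m → ℤ := fun γ i => ⌊γ i / η⌋ with hφ
  set Box : Finset (Fin m → ℤ) := Fintype.piFinset fun _ => Finset.Icc (-(N : ℤ)) N with hBox
  have hcoord : ∀ (γ : Param m) i, |γ i| ≤ ‖γ‖ := fun γ i => by
    simpa using PiLp.norm_apply_le γ i
  have hφBox : ∀ γ ∈ S, φ γ ∈ Box := by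
    intro γ hγ
    rw [hBox, Fintype.mem_piFinset]
    intro i
    have h1 : |γ i / η| ≤ N := by
      rw [abs_div, abs_of_pos hη0]
      exact (div_le_div_of_nonneg_right ((hcoord γ i).trans (hS γ hγ)) hη0.le).trans
        (Nat.le_ceil _)
    obtain ⟨h2, h3⟩ := abs_le.1 h1
    rw [Finset.mem_Icc]
    constructor
    · rw [Int.le_floor]; push_cast; exact h2
    · exact Int.cast_le.1 ((Int.floor_le (γ i / η)).trans (h3.trans_eq (Int.cast_natCast N).symm))
  have hex : ∀ k : Fin m → ℤ, ∃ γ : Param m, (∃ γ' ∈ S, φ γ' = k) → γ ∈ S ∧ φ γ = k := by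
    intro k
    by_cases h : ∃ γ' ∈ S, φ γ' = k
    · obtain ⟨γ', h1, h2⟩ := h
      exact ⟨γ', fun _ => ⟨h1, h2⟩⟩
    · exact ⟨0, fun h' => absurd h' h⟩
  choose f hf using hex
  refine ⟨(Box.filter fun k => ∃ γ' ∈ S, φ γ' = k).image f, ?_, ?_, ?_⟩
  · intro g hg
    obtain ⟨k, hk, rfl⟩ := Finset.mem_image.1 hg
    exact (hf k (Finset.mem_filter.1 hk).2).1
  · intro γ hγ
    have hex' : ∃ γ' ∈ S, φ γ' = φ γ := ⟨γ, hγ, rfl⟩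
    refine ⟨f (φ γ), Finset.mem_image_of_mem f (Finset.mem_filter.2 ⟨hφBox γ hγ, hex'⟩), ?_⟩
    have h1 := (hf (φ γ) hex').2
    have h2 : ∀ i, ‖(γ - f (φ γ)) i‖ ^ 2 ≤ η ^ 2 := by
      intro i
      have h3 : ⌊(f (φ γ)) i / η⌋ = ⌊γ i / η⌋ := congrFun h1 i
      have h4 := Int.abs_sub_lt_one_of_floor_eq_floor h3.symm
      rw [← sub_div, abs_div, abs_of_pos hη0, div_lt_one hη0] at h4
      rw [PiLp.sub_apply, Real.norm_eq_abs]
      exact pow_le_pow_left₀ (abs_nonneg _) h4.le 2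
    rw [EuclideanSpace.norm_eq]
    refine Real.sqrt_le_iff.2 ⟨hδ.le, ?_⟩
    calc ∑ i, ‖(γ - f (φ γ)) i‖ ^ 2 ≤ ∑ _i : Fin m, η ^ 2 := Finset.sum_le_sum fun i _ => h2 i
      _ = m * η ^ 2 := by simp
      _ ≤ (m + 1) ^ 2 * η ^ 2 := by
          refine mul_le_mul_of_nonneg_right ?_ (sq_nonneg _)
          have : (0 : ℝ) ≤ m := Nat.cast_nonneg m
          nlinarith
      _ = δ ^ 2 := by rw [hη]; field_simp
  · have h1 : ((Box.filter fun k => ∃ γ' ∈ S, φ γ' = k).image f).card ≤ (2 * N + 1) ^ m := by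
      refine Finset.card_image_le.trans ((Finset.card_filter_le _ _).trans_eq ?_)
      rw [hBox, Fintype.card_piFinset]
      simp only [Int.card_Icc, Finset.prod_const, Finset.card_univ, Fintype.card_fin]
      congr 1; omega
    calc _ ≤ (((2 * N + 1) ^ m : ℕ) : ℝ) := by exact_mod_cast h1
      _ = (2 * (N : ℝ) + 1) ^ m := by push_cast; rfl
      _ ≤ _ := by
          refine pow_le_pow_left₀ (by positivity) ?_ m
          have h2 : (N : ℝ) ≤ d / η + 1 := (Nat.ceil_lt_add_one (by positivity)).le
          have h3 : d / η = (m + 1) * (d / δ) := by rw [hη]; field_simp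
          have h4 : 1 ≤ d / δ := by rw [le_div_iff₀ hδ]; linarith
          rw [mul_div_assoc]
          rw [h3] at h2
          nlinarith

end Deterministic

/-! ### The exponents -/

section Exponents

variable {m : ℕ} {β s c lam : ℝ}

theorem one_sub_theta (hs : 2 < s) (hβ : 2 < β) :
    1 - theta m β s c =
      2 * (β + m * (s - 1) * (1 + c) + s) / (β * s + m * (s - 1) + 1) := by
  have hD : 0 < β * s + m * (s - 1) + 1 := by
    have : 0 ≤ (m : ℝ) * (s - 1) := mul_nonneg (Nat.cast_nonneg m) (by linarith)
    nlinarith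
  rw [theta, eq_div_iff hD.ne', sub_mul, div_mul_cancel₀ _ hD.ne']
  ring

theorem one_sub_theta_pos (hs : 2 < s) (hβ : 2 < β) (hc : 0 < c) : 0 < 1 - theta m β s c := by
  rw [one_sub_theta hs hβ]
  have : 0 ≤ (m : ℝ) * (s - 1) := mul_nonneg (Nat.cast_nonneg m) (by linarith)
  have : 0 ≤ (m : ℝ) * (s - 1) * (1 + c) := by positivity
  have : 0 < β * s := by nlinarith
  positivity

theorem two_le_one_sub_theta_mul (hs : 2 < s) (hβ : 2 < β) (hc : 0 < c) :
    2 ≤ (1 - theta m β s c) * s := by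
  have h1 : 0 ≤ (m : ℝ) * (s - 1) := mul_nonneg (Nat.cast_nonneg m) (by linarith)
  have h2 : 0 < β * s := by nlinarith
  have h3 : 0 ≤ (m : ℝ) * (s - 1) * c := by positivity
  rw [one_sub_theta hs hβ, div_mul_eq_mul_div, le_div_iff₀ (by positivity)]
  nlinarith

/-- The exponent `θ` is chosen so that the number of grid points, times the number of blocks,
times the mixing coefficient at the block length is a negative power of `T`. -/
theorem rate_exponent_neg (hs : 2 < s) (hβ : 2 < β) (hc : 0 < c) :
    (c * m + m + 1 + (β + 1) / (s - 1)) -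
      (1 - theta m β s c) * (m + (β + 1) * (s / (s - 1))) / 2 < 0 := by
  have h1 : 0 ≤ (m : ℝ) * (s - 1) := mul_nonneg (Nat.cast_nonneg m) (by linarith)
  have h2 : 0 < β * s := by nlinarith
  have hs1 : 0 < s - 1 := by linarith
  have hD : 0 < β * s + m * (s - 1) + 1 := by positivity
  have h3 : 0 < β + m * (s - 1) * (1 + c) + s := by
    have : 0 ≤ (m : ℝ) * (s - 1) * (1 + c) := by positivity
    linarith
  have key : (c * m + m + 1 + (β + 1) / (s - 1)) -
      (1 - theta m β s c) * (m + (β + 1) * (s / (s - 1))) / 2 =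
      -((β + m * (s - 1) * (1 + c) + s) / (β * s + m * (s - 1) + 1)) := by
    rw [one_sub_theta hs hβ]
    field_simp
    ring
  rw [key]
  exact neg_neg_of_pos (div_pos h3 hD)

theorem lt_mul_sub_two (hs : 2 < s) (hc : 0 < c)
    (hβ : ((m : ℝ) * (s - 1) * (1 + 2 * c) + 2 * s - 1) / (s - 2) < β) : s < β * (s - 2) := by
  rw [div_lt_iff₀ (by linarith)] at hβ
  have h1 : 0 ≤ (m : ℝ) * (s - 1) := mul_nonneg (Nat.cast_nonneg m) (by linarith)
  have : 0 ≤ (m : ℝ) * (s - 1) * (1 + 2 * c) := by positivity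
  linarith

theorem rateExponent_nonneg (hs : 2 < s) (hβ : 2 < β) (hc : 0 < c) (hlam : 0 ≤ lam) :
    0 ≤ rateExponent m β s c lam := by
  unfold rateExponent
  split_ifs
  · exact hc.le
  · exact le_min hc.le (div_nonneg (one_sub_theta_pos hs hβ hc).le (by positivity))

theorem rateExponent_le : rateExponent m β s c lam ≤ c := by
  unfold rateExponent
  split_ifs
  · exact le_rfl
  · exact min_le_left _ _

end Exponents

/-! ### Rates -/

section Rates

variable {m : ℕ} {β s c T a h : ℝ}

theorem rpow_mul_rpow_le {y e f : ℝ} (hT : 0 < T) (ha : 0 < a) (he : 0 ≤ e)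
    (haT : a ^ 2 * T ^ y ≤ 1) : a ^ e * T ^ f ≤ T ^ (f - y * e / 2) := by
  have h1 : a ^ 2 ≤ T ^ (-y) := by
    rw [Real.rpow_neg hT.le, ← one_div, le_div_iff₀ (by positivity)]
    exact haT
  have h2 : a ^ e = (a ^ 2) ^ (e / 2) := by
    rw [← Real.rpow_natCast, ← Real.rpow_mul ha.le]; congr 1; push_cast; ring
  calc a ^ e * T ^ f ≤ (T ^ (-y)) ^ (e / 2) * T ^ f := by
        rw [h2]
        exact mul_le_mul_of_nonneg_right (Real.rpow_le_rpow (by positivity) h1 (by positivity))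
          (by positivity)
    _ = T ^ (f - y * e / 2) := by
        rw [← Real.rpow_mul hT.le, ← Real.rpow_add hT]; congr 1; ring

/-- The truncation level. It makes the expected truncation error in the kernel average, which is
at most of order `h⁻¹ * truncLevel ^ (1 - s)`, of order `a`. -/
noncomputable def truncLevel (s a h : ℝ) : ℝ := ((a * h)⁻¹) ^ (1 / (s - 1))

theorem truncLevel_rpow (hs : 1 < s) (ha : 0 < a) (hh : 0 < h) :
    truncLevel s a h ^ (1 - s) = a * h := by
  have hah : 0 < a * h := mul_pos ha hh
  rw [truncLevel, ← Real.rpow_mul (by positivity),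
    show 1 / (s - 1) * (1 - s) = -1 by
      have : s - 1 ≠ 0 := by linarith
      field_simp; ring, Real.rpow_neg_one, inv_inv]

theorem truncLevel_pos (ha : 0 < a) (hh : 0 < h) : 0 < truncLevel s a h := by
  unfold truncLevel; positivity

theorem inv_mul_le (ha : 0 < a) (hh : 0 < h) (hah : 1 ≤ a ^ 2 * h * T) : (a * h)⁻¹ ≤ a * T := by
  rw [inv_le_iff_one_le_mul₀ (mul_pos ha hh)]
  nlinarith

theorem mul_truncLevel_le (hs : 2 < s) (hT : 0 < T) (ha : 0 < a) (hh : 0 < h)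
    (hah : 1 ≤ a ^ 2 * h * T) :
    a * truncLevel s a h ≤ a ^ (s / (s - 1)) * T ^ (1 / (s - 1)) := by
  have hs1 : 0 < s - 1 := by linarith
  calc a * truncLevel s a h ≤ a * (a * T) ^ (1 / (s - 1)) := by
        refine mul_le_mul_of_nonneg_left ?_ ha.le
        exact Real.rpow_le_rpow (by positivity) (inv_mul_le ha hh hah) (by positivity)
    _ = a ^ (s / (s - 1)) * T ^ (1 / (s - 1)) := by
        rw [Real.mul_rpow ha.le hT.le, ← mul_assoc]
        congr 1
        nth_rewrite 1 [← Real.rpow_one a]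
        rw [← Real.rpow_add ha]; congr 1; field_simp; ring

/-- The block length `⌊1 / (a * truncLevel s a h)⌋` is at least one. -/
theorem mul_truncLevel_le_one (hs : 2 < s) (hβ : 2 < β) (hc : 0 < c) (hT : 1 ≤ T) (ha : 0 < a)
    (hh : 0 < h) (hah : 1 ≤ a ^ 2 * h * T) (haT : a ^ 2 * T ^ (1 - theta m β s c) ≤ 1) :
    a * truncLevel s a h ≤ 1 := by
  have hs1 : 0 < s - 1 := by linarith
  refine (mul_truncLevel_le hs (by linarith) ha hh hah).trans
    ((rpow_mul_rpow_le (by linarith) ha (by positivity) haT).trans ?_)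
  refine Real.rpow_le_one_of_one_le_of_nonpos hT ?_
  have := two_le_one_sub_theta_mul (m := m) hs hβ hc
  rw [show 1 / (s - 1) - (1 - theta m β s c) * (s / (s - 1)) / 2 =
    (2 - (1 - theta m β s c) * s) / (2 * (s - 1)) by field_simp]
  exact div_nonpos_of_nonpos_of_nonneg (by linarith) (by positivity)

theorem net_card_le (hT : 1 ≤ T) (ha : 0 < a) (hh : 0 < h)
    (hah : 1 ≤ a ^ 2 * h * T) {N d : ℝ} (hd0 : 0 ≤ d) (hd : d ≤ T ^ c)
    (hN : N ≤ ((2 * m + 5) * d / (a * h)) ^ m) :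
    N ≤ (2 * m + 5) ^ m * (a ^ (m : ℝ) * T ^ (c * m + m)) := by
  have hT0 : 0 < T := by linarith
  calc N ≤ ((2 * m + 5) * d / (a * h)) ^ m := hN
    _ ≤ ((2 * m + 5) * (T ^ c * (a * T))) ^ m := by
        refine pow_le_pow_left₀ (by positivity) ?_ m
        rw [mul_div_assoc, div_eq_mul_inv]
        have := inv_mul_le ha hh hah
        gcongr
    _ = _ := by
        rw [mul_pow, mul_pow, mul_pow, Real.rpow_natCast, Real.rpow_add hT0, Real.rpow_mul hT0.le,
          Real.rpow_natCast, Real.rpow_natCast]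
        ring

/-- The contribution of mixing to the union bound over the grid. -/
theorem mixing_rate_le (hs : 2 < s) (hβ : 2 < β) (hT : 1 ≤ T) (ha : 0 < a)
    (hh : 0 < h) (hah : 1 ≤ a ^ 2 * h * T) (haT : a ^ 2 * T ^ (1 - theta m β s c) ≤ 1)
    {N q : ℝ}
    (hN : N ≤ (2 * m + 5) ^ m * (a ^ (m : ℝ) * T ^ (c * m + m)))
    (hq : 1 ≤ 2 * (a * truncLevel s a h) * q) (hq0 : 0 < q) :
    N * (T * q ^ (-(β + 1))) ≤ (2 * m + 5) ^ m * 2 ^ (β + 1) *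
      T ^ ((c * m + m + 1 + (β + 1) / (s - 1)) -
        (1 - theta m β s c) * (m + (β + 1) * (s / (s - 1))) / 2) := by
  have hT0 : 0 < T := by linarith
  have hs1 : 0 < s - 1 := by linarith
  have hτ := truncLevel_pos (s := s) ha hh
  have hq' : q ^ (-(β + 1)) ≤ (2 * (a ^ (s / (s - 1)) * T ^ (1 / (s - 1)))) ^ (β + 1) := by
    rw [Real.rpow_neg hq0.le, ← Real.inv_rpow hq0.le]
    refine Real.rpow_le_rpow (by positivity) ?_ (by linarith)
    have h1 : q⁻¹ ≤ 2 * (a * truncLevel s a h) := by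
      rw [inv_le_iff_one_le_mul₀ hq0]; linarith
    linarith [mul_truncLevel_le hs hT0 ha hh hah]
  have e1 : (2 * (a ^ (s / (s - 1)) * T ^ (1 / (s - 1)))) ^ (β + 1) =
      2 ^ (β + 1) * (a ^ ((β + 1) * (s / (s - 1))) * T ^ ((β + 1) / (s - 1))) := by
    rw [Real.mul_rpow (by norm_num) (by positivity), Real.mul_rpow (by positivity) (by positivity),
      ← Real.rpow_mul ha.le, ← Real.rpow_mul hT0.le]
    congr 3 <;> ring_nf
  calc N * (T * q ^ (-(β + 1)))
      ≤ ((2 * m + 5) ^ m * (a ^ (m : ℝ) * T ^ (c * m + m))) * (T *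
        (2 ^ (β + 1) * (a ^ ((β + 1) * (s / (s - 1))) * T ^ ((β + 1) / (s - 1))))) := by
        rw [← e1]
        exact mul_le_mul hN (mul_le_mul_of_nonneg_left hq' hT0.le) (by positivity)
          (by positivity)
    _ = (2 * m + 5) ^ m * 2 ^ (β + 1) * (a ^ ((m : ℝ) + (β + 1) * (s / (s - 1))) *
          T ^ (c * m + m + 1 + (β + 1) / (s - 1))) := by
        rw [Real.rpow_add ha, Real.rpow_add hT0 (c * m + m + 1), Real.rpow_add hT0 (c * m + m) 1,
          Real.rpow_one]
        ring
    _ ≤ _ := by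
        refine mul_le_mul_of_nonneg_left ?_ (by positivity)
        exact rpow_mul_rpow_le hT0 ha (by positivity) haT

end Rates

/-! ### Moments and Markov's inequality -/

section Moments

variable {Ω : Type*} {mΩ : MeasurableSpace Ω} {P : Measure Ω}

theorem integrable_and_integral_le_of_lintegral_le {f : Ω → ℝ} {B : ℝ} (hf : Measurable f)
    (h0 : ∀ ω, 0 ≤ f ω) (hB : 0 ≤ B)
    (h : ∫⁻ ω, ENNReal.ofReal (f ω) ∂P ≤ ENNReal.ofReal B) :
    Integrable f P ∧ ∫ ω, f ω ∂P ≤ B := by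
  refine ⟨(lintegral_ofReal_ne_top_iff_integrable hf.aestronglyMeasurable
    (Eventually.of_forall h0)).1 (h.trans_lt ENNReal.ofReal_lt_top).ne, ?_⟩
  rw [integral_eq_lintegral_of_nonneg_ae (Eventually.of_forall h0) hf.aestronglyMeasurable]
  exact ENNReal.toReal_le_of_le_ofReal hB h

theorem integrable_of_integrable_rpow [IsFiniteMeasure P] {X : Ω → ℝ} {s : ℝ} (hs : 1 ≤ s)
    (hX : Measurable X) (h : Integrable (fun ω => |X ω| ^ s) P) : Integrable X P :=
  ((integrable_const (1 : ℝ)).add h).mono' hX.aestronglyMeasurable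
    (Eventually.of_forall fun ω => abs_le_one_add_rpow hs (X ω))

/-- Markov's inequality for the row sums of `s`-th powers, uniformly over a finite set of
parameters. Only the supremum over that finite set has to be measurable. -/
theorem measure_exists_sum_rpow_gt_le {m : ℕ} {ζ : ℕ → Param m → Ω → ℝ} {S : Set (Param m)}
    {G : Finset (Param m)} {T : ℕ} {s B R : ℝ} (hG : ∀ g ∈ G, g ∈ S) (hT : 1 ≤ T) (hR : 0 < R)
    (hζ : ∀ i, 1 ≤ i → i ≤ T → ∀ g ∈ G, Measurable (ζ i g))
    (hB : ∀ i, 1 ≤ i → i ≤ T →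
      ∫⁻ ω, (⨆ γ ∈ S, ENNReal.ofReal (|ζ i γ ω| ^ s)) ∂P ≤ ENNReal.ofReal B) :
    P {ω | ∃ g ∈ G, T * R < ∑ i ∈ Finset.Icc 1 T, |ζ i g ω| ^ s} ≤ ENNReal.ofReal (B / R) := by
  have hT0 : (0 : ℝ) < T := by exact_mod_cast hT
  set F : ℕ → Ω → ℝ≥0∞ := fun i ω => ⨆ g ∈ G, ENNReal.ofReal (|ζ i g ω| ^ s) with hF
  have hFm : ∀ i ∈ Finset.Icc 1 T, Measurable (F i) := fun i hi =>
    Measurable.biSup (G : Set (Param m)) G.countable_toSet fun g hg =>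
      ((hζ i (Finset.mem_Icc.1 hi).1 (Finset.mem_Icc.1 hi).2 g hg).abs.pow_const s).ennreal_ofReal
  have hFi : ∀ i ∈ Finset.Icc 1 T, ∫⁻ ω, F i ω ∂P ≤ ENNReal.ofReal B := fun i hi =>
    (lintegral_mono fun ω => biSup_mono fun g hg => hG g hg).trans
      (hB i (Finset.mem_Icc.1 hi).1 (Finset.mem_Icc.1 hi).2)
  have hsub : {ω | ∃ g ∈ G, T * R < ∑ i ∈ Finset.Icc 1 T, |ζ i g ω| ^ s} ⊆
      {ω | ENNReal.ofReal (T * R) ≤ ∑ i ∈ Finset.Icc 1 T, F i ω} := by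
    rintro ω ⟨g, hg, hlt⟩
    refine (ENNReal.ofReal_le_ofReal hlt.le).trans ?_
    rw [ENNReal.ofReal_sum_of_nonneg fun i _ => by positivity]
    exact Finset.sum_le_sum fun i _ =>
      le_iSup₂ (f := fun g (_ : g ∈ G) => ENNReal.ofReal (|ζ i g ω| ^ s)) g hg
  have hTR : 0 < T * R := mul_pos hT0 hR
  calc P _ ≤ P {ω | ENNReal.ofReal (T * R) ≤ ∑ i ∈ Finset.Icc 1 T, F i ω} := measure_mono hsub
    _ ≤ (∫⁻ ω, ∑ i ∈ Finset.Icc 1 T, F i ω ∂P) / ENNReal.ofReal (T * R) :=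
        meas_ge_le_lintegral_div (Finset.measurable_fun_sum _ hFm).aemeasurable
          (ENNReal.ofReal_pos.2 hTR).ne' ENNReal.ofReal_ne_top
    _ ≤ (∑ i ∈ Finset.Icc 1 T, ENNReal.ofReal B) / ENNReal.ofReal (T * R) := by
        rw [lintegral_finsetSum' _ fun i hi => (hFm i hi).aemeasurable]
        exact ENNReal.div_le_div_right (Finset.sum_le_sum hFi) _
    _ = ENNReal.ofReal (B / R) := by
        rw [Finset.sum_const, Nat.card_Icc, Nat.add_sub_cancel, nsmul_eq_mul,
          ← ENNReal.ofReal_natCast, ← ENNReal.ofReal_mul hT0.le, ← ENNReal.ofReal_div_of_pos hTR,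
          mul_div_mul_left _ _ hT0.ne']

end Moments

/-! ### Discretization of the parameter and truncation -/

section Approximation

variable {Ω : Type*} {mΩ : MeasurableSpace Ω} {P : Measure Ω} [IsProbabilityMeasure P]

theorem integral_abs_le_one_add {X : Ω → ℝ} {s μ : ℝ} (hs : 1 ≤ s)
    (hXs : Integrable (fun ω => |X ω| ^ s) P) (hXμ : ∫ ω, |X ω| ^ s ∂P ≤ μ) :
    ∫ ω, |X ω| ∂P ≤ 1 + μ := by
  calc ∫ ω, |X ω| ∂P ≤ ∫ ω, (1 + |X ω| ^ s) ∂P :=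
        integral_mono_of_nonneg (Eventually.of_forall fun ω => abs_nonneg _)
          ((integrable_const _).add hXs)
          (Eventually.of_forall fun ω => abs_le_one_add_rpow hs (X ω))
    _ = 1 + ∫ ω, |X ω| ^ s ∂P := by rw [integral_add (integrable_const _) hXs]; simp
    _ ≤ 1 + μ := by linarith

/-- The cost of replacing a variable `U` by a neighbour `V` and then truncating `V`. -/
theorem abs_centred_sub_centred_clamp_le {U V ξ : Ω → ℝ} {s μ δ τ : ℝ} {ω : Ω} (hs : 1 ≤ s)
    (hτ : 0 < τ) (hτδ : τ ^ (1 - s) = δ) (hU : Integrable U P) (hVm : Measurable V)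
    (hξm : Measurable ξ)
    (hVs : Integrable (fun ω => |V ω| ^ s) P) (hξs : Integrable (fun ω => |ξ ω| ^ s) P)
    (hVμ : ∫ ω, |V ω| ^ s ∂P ≤ μ) (hξμ : ∫ ω, |ξ ω| ^ s ∂P ≤ μ)
    (hUV : ∀ᵐ ω' ∂P, |U ω' - V ω'| ≤ ξ ω' * δ) (hω : |U ω - V ω| ≤ ξ ω * δ) :
    |U ω - ∫ ω', U ω' ∂P - (clamp τ (V ω) - ∫ ω', clamp τ (V ω') ∂P)| ≤
      δ * (2 + 2 * μ + |V ω| ^ s + |ξ ω| ^ s) := by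
  have hδ0 : 0 ≤ δ := by rw [← hτδ]; positivity
  have hV : Integrable V P := integrable_of_integrable_rpow hs hVm hVs
  have hξ : Integrable ξ P := integrable_of_integrable_rpow hs hξm hξs
  have hcm : Measurable fun ω => clamp τ (V ω) := (measurable_clamp τ).comp hVm
  have hc : Integrable (fun ω => clamp τ (V ω)) P :=
    integrable_of_abs_le hcm fun ω => abs_clamp_le hτ.le (V ω)
  have e1 : |∫ ω', U ω' ∂P - ∫ ω', V ω' ∂P| ≤ δ * (1 + μ) := by
    rw [← integral_sub hU hV]
    calc |∫ ω', (U ω' - V ω') ∂P| ≤ ∫ ω', |U ω' - V ω'| ∂P := abs_integral_le_integral_abs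
      _ ≤ ∫ ω', |ξ ω'| * δ ∂P := by
          refine integral_mono_of_nonneg (Eventually.of_forall fun ω => abs_nonneg _)
            (hξ.abs.mul_const δ) ?_
          filter_upwards [hUV] with ω' h
          exact h.trans (mul_le_mul_of_nonneg_right (le_abs_self _) hδ0)
      _ = (∫ ω', |ξ ω'| ∂P) * δ := integral_mul_const _ _
      _ ≤ (1 + μ) * δ := mul_le_mul_of_nonneg_right (integral_abs_le_one_add hs hξs hξμ) hδ0
      _ = δ * (1 + μ) := mul_comm _ _
  have e2 : |∫ ω', V ω' ∂P - ∫ ω', clamp τ (V ω') ∂P| ≤ δ * μ := by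
    rw [← integral_sub hV hc]
    calc |∫ ω', (V ω' - clamp τ (V ω')) ∂P| ≤ ∫ ω', |V ω' - clamp τ (V ω')| ∂P :=
          abs_integral_le_integral_abs
      _ ≤ ∫ ω', δ * |V ω'| ^ s ∂P :=
          integral_mono_of_nonneg (Eventually.of_forall fun ω => abs_nonneg _) (hVs.const_mul δ)
            (Eventually.of_forall fun ω' => hτδ ▸ abs_sub_clamp_le_rpow hτ hs (V ω'))
      _ = δ * ∫ ω', |V ω'| ^ s ∂P := integral_const_mul _ _
      _ ≤ δ * μ := mul_le_mul_of_nonneg_left hVμ hδ0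
  have e3 : |V ω - clamp τ (V ω)| ≤ δ * |V ω| ^ s := hτδ ▸ abs_sub_clamp_le_rpow hτ hs (V ω)
  have e4 : |U ω - V ω| ≤ δ * (1 + |ξ ω| ^ s) := by
    have := mul_le_mul_of_nonneg_right ((le_abs_self (ξ ω)).trans (abs_le_one_add_rpow hs (ξ ω)))
      hδ0
    linarith
  have : U ω - ∫ ω', U ω' ∂P - (clamp τ (V ω) - ∫ ω', clamp τ (V ω') ∂P) =
      (U ω - V ω) + (V ω - clamp τ (V ω)) - (∫ ω', U ω' ∂P - ∫ ω', V ω' ∂P) -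
        (∫ ω', V ω' ∂P - ∫ ω', clamp τ (V ω') ∂P) := by ring
  rw [this]
  rw [abs_le] at *
  constructor <;> linarith [e1.1, e1.2, e2.1, e2.2, e3.1, e3.2, e4.1, e4.2]

theorem kernelAverage_eq {m : ℕ} (K : ℝ → ℝ) (h : ℕ → ℝ) (j : ℕ) (ε : ParamArray m Ω) (T : ℕ)
    (x : ℝ) (γ : Param m) (ω : Ω) :
    kernelAverage K h j ε T x γ ω = (T * h T)⁻¹ * ∑ i ∈ Finset.Icc 1 T, ε T i γ ω *
      (K (((i : ℝ) / T - x) / h T) * (((i : ℝ) / T - x) / h T) ^ j) := by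
  rw [kernelAverage, mul_inv, mul_assoc, Finset.mul_sum _ _ (h T)⁻¹]
  congr 1
  refine Finset.sum_congr rfl fun i _ => ?_
  rw [scaledKernel]; ring

/-- The deviation of the kernel average at `γ` is that of the truncated kernel average at a
neighbour `g` of `γ`, up to moments of the array at `g`. -/
theorem abs_kernelAverage_sub_integral_le {m : ℕ} {K : ℝ → ℝ} {h : ℕ → ℝ} {j : ℕ}
    {ε ξ : ParamArray m Ω} {T : ℕ} {x : ℝ} {γ g : Param m} {ω : Ω} {s μ δ τ W R M : ℝ}
    (hT : 1 ≤ T) (hh : 0 < h T) (hW : ∀ u, |K u * u ^ j| ≤ W) (hs : 1 ≤ s)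
    (hτ : 0 < τ) (hτδ : τ ^ (1 - s) = δ)
    (hγ : ∀ i, 1 ≤ i → i ≤ T → Integrable (ε T i γ) P)
    (hgm : ∀ i, 1 ≤ i → i ≤ T → Measurable (ε T i g))
    (hξm : ∀ i, 1 ≤ i → i ≤ T → Measurable (ξ T i g))
    (hgs : ∀ i, 1 ≤ i → i ≤ T →
      Integrable (fun ω => |ε T i g ω| ^ s) P ∧ ∫ ω, |ε T i g ω| ^ s ∂P ≤ μ)
    (hξs : ∀ i, 1 ≤ i → i ≤ T →
      Integrable (fun ω => |ξ T i g ω| ^ s) P ∧ ∫ ω, |ξ T i g ω| ^ s ∂P ≤ μ)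
    (hlip : ∀ᵐ ω' ∂P, ∀ i, 1 ≤ i → i ≤ T → |ε T i γ ω' - ε T i g ω'| ≤ ξ T i g ω' * δ)
    (hlipω : ∀ i, 1 ≤ i → i ≤ T → |ε T i γ ω - ε T i g ω| ≤ ξ T i g ω * δ)
    (hεR : ∑ i ∈ Finset.Icc 1 T, |ε T i g ω| ^ s ≤ T * R)
    (hξR : ∑ i ∈ Finset.Icc 1 T, |ξ T i g ω| ^ s ≤ T * R)
    (hM : |∑ i ∈ Finset.Icc 1 T, centredClamp P (fun l => ε T l g) T τ i ω *
      (K (((i : ℝ) / T - x) / h T) * (((i : ℝ) / T - x) / h T) ^ j)| ≤ M) :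
    |kernelAverage K h j ε T x γ ω - ∫ ω', kernelAverage K h j ε T x γ ω' ∂P| ≤
      W * (δ / h T) * (2 + 2 * μ + 2 * R) + M / (T * h T) := by
  have hT0 : (0 : ℝ) < T := by exact_mod_cast hT
  have hW0 : 0 ≤ W := (abs_nonneg _).trans (hW 0)
  have hδ0 : 0 ≤ δ := by rw [← hτδ]; positivity
  set k : ℕ → ℝ := fun i =>
    K (((i : ℝ) / T - x) / h T) * (((i : ℝ) / T - x) / h T) ^ j with hk
  set Y : ℕ → ℝ := fun i => centredClamp P (fun l => ε T l g) T τ i ω with hY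
  have hmean : ∫ ω', kernelAverage K h j ε T x γ ω' ∂P =
      (T * h T)⁻¹ * ∑ i ∈ Finset.Icc 1 T, (∫ ω', ε T i γ ω' ∂P) * k i := by
    simp only [kernelAverage_eq]
    rw [integral_const_mul, integral_finsetSum _ fun i hi =>
      (hγ i (Finset.mem_Icc.1 hi).1 (Finset.mem_Icc.1 hi).2).mul_const _]
    simp only [integral_mul_const, hk]
  have hterm : ∀ i ∈ Finset.Icc 1 T, |(ε T i γ ω - ∫ ω', ε T i γ ω' ∂P - Y i) * k i| ≤
      δ * (2 + 2 * μ + |ε T i g ω| ^ s + |ξ T i g ω| ^ s) * W := by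
    intro i hi
    obtain ⟨h1, h2⟩ := Finset.mem_Icc.1 hi
    have hYi : Y i = clamp τ (ε T i g ω) - ∫ ω', clamp τ (ε T i g ω') ∂P := by
      simp only [hY, centredClamp]; rw [if_pos ⟨h1, h2⟩]
    have := abs_centred_sub_centred_clamp_le (ω := ω) hs hτ hτδ (hγ i h1 h2) (hgm i h1 h2)
      (hξm i h1 h2) (hgs i h1 h2).1 (hξs i h1 h2).1 (hgs i h1 h2).2 (hξs i h1 h2).2
      (by filter_upwards [hlip] with ω' h' using h' i h1 h2) (hlipω i h1 h2)
    rw [abs_mul, hYi]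
    exact mul_le_mul this (hW _) (abs_nonneg _) ((abs_nonneg _).trans this)
  have hsplit : kernelAverage K h j ε T x γ ω - ∫ ω', kernelAverage K h j ε T x γ ω' ∂P =
      (T * h T)⁻¹ * (∑ i ∈ Finset.Icc 1 T, (ε T i γ ω - ∫ ω', ε T i γ ω' ∂P - Y i) * k i +
        ∑ i ∈ Finset.Icc 1 T, Y i * k i) := by
    rw [hmean, kernelAverage_eq, ← mul_sub, ← Finset.sum_sub_distrib, ← Finset.sum_add_distrib]
    congr 1
    refine Finset.sum_congr rfl fun i _ => ?_
    simp only [hk]; ring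
  have hfirst : |∑ i ∈ Finset.Icc 1 T, (ε T i γ ω - ∫ ω', ε T i γ ω' ∂P - Y i) * k i| ≤
      δ * W * (T * (2 + 2 * μ + 2 * R)) := by
    calc _ ≤ ∑ i ∈ Finset.Icc 1 T, |(ε T i γ ω - ∫ ω', ε T i γ ω' ∂P - Y i) * k i| :=
          Finset.abs_sum_le_sum_abs _ _
      _ ≤ ∑ i ∈ Finset.Icc 1 T, δ * (2 + 2 * μ + |ε T i g ω| ^ s + |ξ T i g ω| ^ s) * W :=
          Finset.sum_le_sum hterm
      _ = δ * W * (T * (2 + 2 * μ) + (∑ i ∈ Finset.Icc 1 T, |ε T i g ω| ^ s +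
            ∑ i ∈ Finset.Icc 1 T, |ξ T i g ω| ^ s)) := by
          rw [← Finset.sum_mul, ← Finset.mul_sum, Finset.sum_add_distrib, Finset.sum_add_distrib]
          simp; ring
      _ ≤ _ := mul_le_mul_of_nonneg_left (by linarith) (by positivity)
  have hTh : 0 < T * h T := mul_pos hT0 hh
  rw [hsplit, abs_mul, abs_of_pos (inv_pos.2 hTh), inv_mul_eq_div, div_le_iff₀ hTh]
  calc _ ≤ δ * W * (T * (2 + 2 * μ + 2 * R)) + M := (abs_add_le _ _).trans (add_le_add hfirst hM)
    _ = _ := by field_simp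

end Approximation

/-! ### Union bound over the net -/

section Grid

variable {Ω : Type*} {mΩ : MeasurableSpace Ω} {P : Measure Ω} [IsProbabilityMeasure P]

/-- The union bound over a finite set of parameters and over all windows. -/
theorem measure_exists_grid_le {m : ℕ} {X : Param m → ℕ → Ω → ℝ} {G : Finset (Param m)}
    {A β s τ μ t y : ℝ} {T w q : ℕ}
    (hX : ∀ g ∈ G, ∀ i, 1 ≤ i → i ≤ T → Measurable (X g i)) (hA : 0 ≤ A) (hβ : 0 ≤ β)
    (hs : 2 < s) (hη : s < β * (s - 2))
    (hmix : ∀ g ∈ G, ∀ i : ℕ, 1 ≤ i → alphaCoeff P (X g) T i ≤ A * (i : ℝ) ^ (-β))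
    (hτ : 0 < τ) (hμ : 1 ≤ μ)
    (hmom : ∀ g ∈ G, ∀ i, 1 ≤ i → i ≤ T → ∫ ω, |clamp τ (X g i ω)| ^ s ∂P ≤ μ)
    (hq : 1 ≤ q) (ht : 0 < t) (hy : 0 < y) (htb : t * (q * (2 * τ)) ≤ 1)
    (htV : t ^ 2 * ((3 * w : ℕ) * (blockConst A β s * μ ^ 2)) ≤ t * y / 4) :
    P.real {ω | ∃ g ∈ G, ∃ v ≤ T / w, ∃ l ≤ 3 * w, 2 * y + q * (2 * τ) <
        |∑ i ∈ Finset.range l, centredClamp P (X g) T τ (w * v + 1 + i) ω|} ≤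
      G.card * (((T / w : ℕ) + 1 : ℝ) * (4 * ((((3 * w / q : ℕ) : ℝ) + 1) *
        Real.exp (-(t * y / 2)) +
        4 / (t * y) * ((3 * w / q : ℕ) * (2 * Real.exp 1 * (A * (q : ℝ) ^ (-β))))))) := by
  set Q : ℝ := 4 * ((((3 * w / q : ℕ) : ℝ) + 1) * Real.exp (-(t * y / 2)) +
        4 / (t * y) * ((3 * w / q : ℕ) * (2 * Real.exp 1 * (A * (q : ℝ) ^ (-β)))))
  have hsub : {ω | ∃ g ∈ G, ∃ v ≤ T / w, ∃ l ≤ 3 * w, 2 * y + q * (2 * τ) <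
        |∑ i ∈ Finset.range l, centredClamp P (X g) T τ (w * v + 1 + i) ω|} ⊆
      ⋃ g ∈ G, ⋃ v ∈ Finset.range (T / w + 1), {ω | ∃ l ≤ 3 * w, 2 * y + q * (2 * τ) <
        |∑ i ∈ Finset.range l, centredClamp P (X g) T τ (w * v + 1 + i) ω|} := by
    rintro ω ⟨g, hg, v, hv, hω⟩
    simp only [Set.mem_iUnion]
    exact ⟨g, hg, v, Finset.mem_range.2 (by omega), hω⟩
  calc _ ≤ _ := measureReal_mono hsub (measure_ne_top _ _)
    _ ≤ ∑ g ∈ G, _ := measureReal_biUnion_finset_le _ _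
    _ ≤ ∑ g ∈ G, ∑ v ∈ Finset.range (T / w + 1), Q := by
        refine Finset.sum_le_sum fun g hg => (measureReal_biUnion_finset_le _ _).trans
          (Finset.sum_le_sum fun v _ => ?_)
        exact measure_exists_abs_sum_centredClamp_gt_le (hX g hg) hA hβ hs hη (hmix g hg) hτ hμ
          (hmom g hg) hq ht hy htb htV
    _ = _ := by simp

end Grid

/-! ### The tail bound -/

section Assembly

/-- The bound for the probability that a partial sum is large at one of the grid points. Both
exponents of `T` are negative. -/
noncomputable def tailBound (m : ℕ) (A β s c L : ℝ) (T : ℕ) : ℝ :=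
  56 * L * (2 * m + 5) ^ m * (T : ℝ) ^ (-1 : ℝ) +
    288 * Real.exp 1 * A * L * ((2 * m + 5) ^ m * 2 ^ (β + 1)) *
      (T : ℝ) ^ ((c * m + m + 1 + (β + 1) / (s - 1)) -
        (1 - theta m β s c) * (m + (β + 1) * (s / (s - 1))) / 2)

/-- The bound of `measure_exists_grid_le` is a sum of negative powers of `T`. -/
theorem grid_bound_le {m T w q : ℕ} {A β s c a h L M₁ N z : ℝ} (hs : 2 < s) (hβ : 2 < β)
    (hc : 0 < c) (hA : 0 ≤ A) (hT : 1 ≤ T) (hlog : 1 ≤ Real.log T) (ha : 0 < a) (ha1 : a ≤ 1)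
    (hh : 0 < h) (hah : 1 ≤ a ^ 2 * h * T) (haT : a ^ 2 * (T : ℝ) ^ (1 - theta m β s c) ≤ 1)
    (hL : 1 ≤ L) (hw : 1 ≤ w) (hwT : (w : ℝ) ≤ 2 * L * T) (hq : 1 ≤ q)
    (hq' : 1 ≤ 2 * (a * truncLevel s a h) * q) (hM₁ : 2 * (c * m + m + 3) ≤ M₁)
    (hz : z = M₁ * Real.log T) (hN0 : 0 ≤ N)
    (hN : N ≤ (2 * m + 5) ^ m * (a ^ (m : ℝ) * (T : ℝ) ^ (c * m + m))) :
    N * (((T / w : ℕ) + 1 : ℝ) * (4 * ((((3 * w / q : ℕ) : ℝ) + 1) * Real.exp (-(z / 2)) +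
      4 / z * ((3 * w / q : ℕ) * (2 * Real.exp 1 * (A * (q : ℝ) ^ (-β))))))) ≤
    tailBound m A β s c L T := by
  have hT1 : (1 : ℝ) ≤ T := by exact_mod_cast hT
  have hT0 : (0 : ℝ) < T := by linarith
  have hw1 : (1 : ℝ) ≤ w := by exact_mod_cast hw
  have hq1 : (1 : ℝ) ≤ q := by exact_mod_cast hq
  have hcm : 0 ≤ c * m + m := by positivity
  have hM1 : 1 ≤ M₁ := by linarith
  have hz1 : 1 ≤ z := by rw [hz]; nlinarith
  have hn : ((3 * w / q : ℕ) : ℝ) ≤ 3 * w / q := by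
    have := @Nat.cast_div_le ℝ _ _ _ (3 * w) q
    push_cast at this; exact this
  have hTw : ((T / w : ℕ) : ℝ) ≤ T / w := Nat.cast_div_le
  have hTw1 : ((T / w : ℕ) : ℝ) ≤ T := hTw.trans (div_le_self hT0.le hw1)
  have hn1 : ((3 * w / q : ℕ) : ℝ) ≤ 3 * w := hn.trans (div_le_self (by positivity) hq1)
  have hexp : Real.exp (-(z / 2)) = (T : ℝ) ^ (-(M₁ / 2)) := by
    rw [Real.rpow_def_of_pos hT0, hz]; congr 1; ring
  have hNle : N ≤ (2 * m + 5) ^ m * (T : ℝ) ^ (c * m + m) := by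
    refine hN.trans (mul_le_mul_of_nonneg_left ?_ (by positivity))
    exact mul_le_of_le_one_left (by positivity)
      (Real.rpow_le_one ha.le ha1 (Nat.cast_nonneg m))
  have hfirst : N * (((T / w : ℕ) + 1 : ℝ) * (4 * ((((3 * w / q : ℕ) : ℝ) + 1) *
      Real.exp (-(z / 2))))) ≤ 56 * L * (2 * m + 5) ^ m * (T : ℝ) ^ (-1 : ℝ) := by
    have h1 : (((T / w : ℕ) + 1 : ℝ)) ≤ 2 * T := by linarith
    have h2 : ((3 * w / q : ℕ) : ℝ) + 1 ≤ 7 * L * T := by nlinarith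
    calc _ ≤ ((2 * m + 5) ^ m * (T : ℝ) ^ (c * m + m)) * (2 * T * (4 * (7 * L * T *
          (T : ℝ) ^ (-(M₁ / 2))))) := by rw [hexp]; gcongr
      _ = 56 * L * (2 * m + 5) ^ m * ((T : ℝ) ^ (c * m + m) * (T : ℝ) ^ (2 : ℝ) *
          (T : ℝ) ^ (-(M₁ / 2))) := by rw [Real.rpow_two]; ring
      _ ≤ _ := by
          rw [← Real.rpow_add hT0, ← Real.rpow_add hT0]
          refine mul_le_mul_of_nonneg_left ?_ (by positivity)
          exact Real.rpow_le_rpow_of_exponent_le hT1 (by linarith)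
  have hsecond : N * (((T / w : ℕ) + 1 : ℝ) * (4 * (4 / z * ((3 * w / q : ℕ) *
      (2 * Real.exp 1 * (A * (q : ℝ) ^ (-β))))))) ≤
      288 * Real.exp 1 * A * L * (N * (T * (q : ℝ) ^ (-(β + 1)))) := by
    have h1 : (((T / w : ℕ) + 1 : ℝ)) * ((3 * w / q : ℕ) : ℝ) ≤ 9 * L * T / q := by
      calc _ ≤ ((T / w : ℝ) + 1) * (3 * w / q) := by gcongr
        _ = (3 * T + 3 * w) / q := by field_simp
        _ ≤ _ := by
            refine div_le_div_of_nonneg_right ?_ (by positivity)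
            nlinarith
    have h2 : 4 / z ≤ 4 := div_le_self (by norm_num) hz1
    have h3 : (q : ℝ) ^ (-(β + 1)) = (q : ℝ) ^ (-β) / q := by
      rw [neg_add, Real.rpow_add (by linarith), Real.rpow_neg_one]; rfl
    calc _ = N * ((((T / w : ℕ) + 1 : ℝ) * ((3 * w / q : ℕ) : ℝ)) * (4 * (4 / z *
          (2 * Real.exp 1 * (A * (q : ℝ) ^ (-β)))))) := by ring
      _ ≤ N * ((9 * L * T / q) * (4 * (4 * (2 * Real.exp 1 * (A * (q : ℝ) ^ (-β)))))) := by
          gcongr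
      _ = _ := by rw [h3]; ring
  have hmix := mixing_rate_le hs hβ hT1 ha hh hah haT hN hq' (by linarith)
  have hC : 0 ≤ 288 * Real.exp 1 * A * L := by positivity
  have := mul_le_mul_of_nonneg_left hmix hC
  calc _ = N * (((T / w : ℕ) + 1 : ℝ) * (4 * ((((3 * w / q : ℕ) : ℝ) + 1) *
      Real.exp (-(z / 2))))) + N * (((T / w : ℕ) + 1 : ℝ) * (4 * (4 / z * ((3 * w / q : ℕ) *
      (2 * Real.exp 1 * (A * (q : ℝ) ^ (-β))))))) := by ring
    _ ≤ _ := by unfold tailBound; linarith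

variable {Ω : Type*} {mΩ : MeasurableSpace Ω} {P : Measure Ω} [IsProbabilityMeasure P]

/-- With high probability, all partial sums of the centred truncations over the windows are at most
of order `D * log T / a`, at all grid points simultaneously. The blocks have length
`q = ⌊1 / (a * τ)⌋`, `τ` being the truncation level, so that a block sum is at most of order
`1 / a`. -/
theorem measure_grid_tail_le {m T : ℕ} {X : Param m → ℕ → Ω → ℝ} {G : Finset (Param m)}
    {A β s c a h L M₁ D κ : ℝ} (hs : 2 < s) (hβ : 2 < β) (hc : 0 < c) (hη : s < β * (s - 2))
    (hA : 0 ≤ A) (hT : 1 ≤ T) (hlog : 1 ≤ Real.log T) (ha : 0 < a) (ha1 : a ≤ 1)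
    (hh : 0 < h) (hh1 : h ≤ 1) (hah : a ^ 2 * (T * h) = Real.log T)
    (haT : a ^ 2 * (T : ℝ) ^ (1 - theta m β s c) ≤ 1)
    (hL : 1 ≤ L) (hD : 1 ≤ D) (hκ : 1 ≤ κ)
    (hM₁ : 2 * (c * m + m + 3) + 6 * L * (blockConst A β s * κ ^ 2) ≤ M₁)
    (hN : (G.card : ℝ) ≤ (2 * m + 5) ^ m * (a ^ (m : ℝ) * (T : ℝ) ^ (c * m + m)))
    (hX : ∀ g ∈ G, ∀ i, 1 ≤ i → i ≤ T → Measurable (X g i))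
    (hmix : ∀ g ∈ G, ∀ i : ℕ, 1 ≤ i → alphaCoeff P (X g) T i ≤ A * (i : ℝ) ^ (-β))
    (hmom : ∀ g ∈ G, ∀ i, 1 ≤ i → i ≤ T →
      ∫ ω, |clamp (truncLevel s a h) (X g i ω)| ^ s ∂P ≤ κ * D) :
    P.real {ω | ∃ g ∈ G, ∃ v ≤ T / (⌊L * (T * h)⌋₊ + 1), ∃ l ≤ 3 * (⌊L * (T * h)⌋₊ + 1),
      (4 * M₁ + 2) * (D * (Real.log T / a)) <
        |∑ i ∈ Finset.range l, centredClamp P (X g) T (truncLevel s a h)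
          ((⌊L * (T * h)⌋₊ + 1) * v + 1 + i) ω|} ≤
    tailBound m A β s c L T := by
  set w : ℕ := ⌊L * (T * h)⌋₊ + 1 with hw
  set τ : ℝ := truncLevel s a h with hτdef
  have hT1 : (1 : ℝ) ≤ T := by exact_mod_cast hT
  have hT0 : (0 : ℝ) < T := by linarith
  have hah1 : 1 ≤ a ^ 2 * h * T := by linarith
  have hτ : 0 < τ := truncLevel_pos ha hh
  have haτ : a * τ ≤ 1 := mul_truncLevel_le_one hs hβ hc hT1 ha hh hah1 haT
  have haτ0 : 0 < a * τ := mul_pos ha hτ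
  have hTh0 : 0 < T * h := mul_pos hT0 hh
  have hTh1 : 1 ≤ T * h := by
    have : a ^ 2 ≤ 1 := pow_le_one₀ ha.le ha1
    nlinarith
  have hw1 : 1 ≤ w := by omega
  have hwle : (w : ℝ) ≤ 2 * L * (T * h) := by
    have h1 := Nat.floor_le (mul_nonneg (by linarith : (0 : ℝ) ≤ L) hTh0.le)
    have h2 : 1 ≤ L * (T * h) := one_le_mul_of_one_le_of_one_le hL hTh1
    rw [hw]; push_cast; linarith
  have hwT : (w : ℝ) ≤ 2 * L * T := by
    refine hwle.trans (mul_le_mul_of_nonneg_left ?_ (by positivity))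
    exact mul_le_of_le_one_right hT0.le hh1
  set q : ℕ := ⌊1 / (a * τ)⌋₊ with hq
  have hq1 : 1 ≤ q := by
    rw [hq, Nat.one_le_floor_iff, le_div_iff₀ haτ0]; linarith
  have hqle : a * τ * q ≤ 1 := by
    have := Nat.floor_le (one_div_pos.2 haτ0).le
    rw [le_div_iff₀ haτ0] at this
    linarith
  have hqge : 1 ≤ 2 * (a * τ) * q := by
    have h1 := Nat.lt_floor_add_one (1 / (a * τ))
    rw [div_lt_iff₀ haτ0] at h1
    have h2 : (1 : ℝ) ≤ q := by exact_mod_cast hq1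
    nlinarith
  have hBC : 0 < blockConst A β s := blockConst_pos hA
  have hcm : 0 ≤ c * m + m := by positivity
  have hBL : 0 ≤ 6 * L * (blockConst A β s * κ ^ 2) := by positivity
  have hM0 : 1 ≤ M₁ := by linarith
  have hlog0 : 0 < Real.log T := by linarith
  have hD0 : 0 < D := by linarith
  -- With this `t` and `y`, `t` times a block sum is at most one and `t * y` is of order `log T`.
  set t : ℝ := a / (2 * D) with ht
  set y : ℝ := 2 * D * M₁ * (Real.log T / a) with hy
  have hty : t * y = M₁ * Real.log T := by rw [ht, hy]; field_simp
  have ht0 : 0 < t := by positivity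
  have hy0 : 0 < y := by positivity
  have htb : t * (q * (2 * τ)) ≤ 1 := by
    have : t * (q * (2 * τ)) = a * τ * q / D := by rw [ht]; field_simp
    rw [this, div_le_one hD0]
    linarith
  have htV : t ^ 2 * ((3 * w : ℕ) * (blockConst A β s * (κ * D) ^ 2)) ≤ t * y / 4 := by
    have e1 : t ^ 2 * ((3 * w : ℕ) * (blockConst A β s * (κ * D) ^ 2)) =
        3 / 4 * (blockConst A β s * κ ^ 2) * (a ^ 2 * w) := by
      rw [ht]; push_cast; field_simp; ring
    have e2 : a ^ 2 * w ≤ 2 * L * Real.log T := by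
      rw [← hah]
      calc a ^ 2 * w ≤ a ^ 2 * (2 * L * (T * h)) := by gcongr
        _ = _ := by ring
    rw [e1, hty]
    calc 3 / 4 * (blockConst A β s * κ ^ 2) * (a ^ 2 * w)
        ≤ 3 / 4 * (blockConst A β s * κ ^ 2) * (2 * L * Real.log T) := by gcongr
      _ = (6 * L * (blockConst A β s * κ ^ 2)) * Real.log T / 4 := by ring
      _ ≤ M₁ * Real.log T / 4 := by
          have : 6 * L * (blockConst A β s * κ ^ 2) ≤ M₁ := by linarith
          gcongr
  have hthr : 2 * y + q * (2 * τ) ≤ (4 * M₁ + 2) * (D * (Real.log T / a)) := by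
    have h1 : q * τ ≤ 1 / a := by rw [le_div_iff₀ ha]; linarith
    have h2 : 1 / a ≤ D * (Real.log T / a) := by
      rw [← mul_div_assoc]
      exact div_le_div_of_nonneg_right (one_le_mul_of_one_le_of_one_le hD hlog) ha.le
    rw [hy]
    linarith
  have hgrid := measure_exists_grid_le (P := P) (w := w) hX hA (by linarith) hs hη hmix hτ
    (one_le_mul_of_one_le_of_one_le hκ hD) hmom hq1 ht0 hy0 htb htV
  refine (measureReal_mono ?_ (measure_ne_top _ _)).trans (hgrid.trans
    (grid_bound_le hs hβ hc hA hT hlog ha ha1 hh hah1 haT hL hw1 hwT hq1 hqge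
      (by linarith) hty (Nat.cast_nonneg _) hN))
  rintro ω ⟨g, hg, v, hv, l, hl, hlt⟩
  exact ⟨g, hg, v, hv, l, hl, hthr.trans_lt hlt⟩

end Assembly

/-! ### The uniform deviation -/

section Deviation

variable {Ω : Type*} {mΩ : MeasurableSpace Ω} {P : Measure Ω} [IsProbabilityMeasure P]

/-- The deviation of the kernel average, at a fixed and sufficiently large `T`. -/
theorem measure_supDeviation_gt_le {m j T : ℕ} {Θ : Set (Param m)} {ε ξ : ParamArray m Ω}
    {K : ℝ → ℝ} {h : ℕ → ℝ} {A β s lam c a d D L W Lam M₁ κ ρ : ℝ}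
    (hs : 2 < s) (hβ2 : 2 < β) (hc : 0 < c) (hη : s < β * (s - 2)) (hA : 0 ≤ A)
    (hT : 1 ≤ T) (hlog : 1 ≤ Real.log T) (ha : 0 < a) (ha1 : a ≤ 1) (hh : 0 < h T)
    (hh1 : h T ≤ 1) (hah : a ^ 2 * (T * h T) = Real.log T)
    (haT : a ^ 2 * (T : ℝ) ^ (1 - theta m β s c) ≤ 1)
    (hL : 1 ≤ L) (hLam : 0 ≤ Lam) (hgW : ∀ u, |K u * u ^ j| ≤ W)
    (hgLip : ∀ u u', |K u * u ^ j - K u' * u' ^ j| ≤ Lam * |u - u'|)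
    (hgs : ∀ u, L < |u| → K u * u ^ j = 0)
    (hd1 : 1 ≤ d) (hdT : d ≤ (T : ℝ) ^ c) (hD1 : 1 ≤ D) (hκ1 : 1 ≤ κ) (hρ0 : 0 < ρ)
    (hM₁ : 2 * (c * m + m + 3) + 6 * L * (blockConst A β s * κ ^ 2) ≤ M₁)
    (hεmeas : ∀ i : ℕ, 1 ≤ i → i ≤ T → ∀ γ ∈ Θ, Measurable (ε T i γ))
    (hmixA : ∀ γ ∈ Θ, ∀ i : ℕ, 1 ≤ i →
      alphaCoeff P (fun l => ε T l γ) T i ≤ A * (i : ℝ) ^ (-β))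
    (hdep : ParamDependence P Θ ε ξ h s lam)
    (hBε : ∀ i, 1 ≤ i → i ≤ T → ∫⁻ ω, (⨆ γ ∈ {γ ∈ Θ | ‖γ‖ ≤ d},
      ENNReal.ofReal (|ε T i γ ω| ^ s)) ∂P ≤ ENNReal.ofReal (κ * D))
    (hBξ : ∀ i, 1 ≤ i → i ≤ T → ∫⁻ ω, (⨆ γ ∈ {γ ∈ Θ | ‖γ‖ ≤ d},
      ENNReal.ofReal (|ξ T i γ ω| ^ s)) ∂P ≤ ENNReal.ofReal (κ * D)) :
    P {ω | ENNReal.ofReal ((W * (2 + 2 * κ + 2 * ρ) + (W + 6 * L * Lam) *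
      (4 * M₁ + 2)) * (D * a)) < supDeviation P K h j Θ ε T d ω} ≤
      ENNReal.ofReal (κ / ρ) + ENNReal.ofReal (κ / ρ) +
        ENNReal.ofReal (tailBound m A β s c L T) := by
  have hT1 : (1 : ℝ) ≤ T := by exact_mod_cast hT
  have hT0 : (0 : ℝ) < T := by linarith
  have hTh0 : 0 < T * h T := mul_pos hT0 hh
  have hD0 : 0 < D := by linarith
  have hBC : 0 < blockConst A β s := blockConst_pos hA
  have hW0 : 0 ≤ W := (abs_nonneg _).trans (hgW 0)
  have hM₁0 : 0 ≤ M₁ := le_trans (by positivity) hM₁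
  set S : Set (Param m) := {γ ∈ Θ | ‖γ‖ ≤ d} with hS
  have hδ0 : 0 < a * h T := mul_pos ha hh
  have hδh : a * h T ≤ h T := mul_le_of_le_one_left hh.le ha1
  obtain ⟨G, hGS, hGnet, hGcard⟩ := exists_finset_net (S := S) hd1 hδ0 (hδh.trans hh1)
    (fun γ hγ => hγ.2)
  have hah1 : 1 ≤ a ^ 2 * h T * T := by linarith
  have hN := net_card_le hT1 ha hh hah1 (by linarith) hdT hGcard
  set τ : ℝ := truncLevel s a (h T) with hτdef
  have hτ : 0 < τ := truncLevel_pos ha hh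
  -- The moment bound for the supremum contains the one at each parameter.
  have hmomS : ∀ (ζ : ParamArray m Ω), (∀ i, 1 ≤ i → i ≤ T → ∫⁻ ω, (⨆ γ ∈ S,
        ENNReal.ofReal (|ζ T i γ ω| ^ s)) ∂P ≤ ENNReal.ofReal (κ * D)) →
      (∀ i, 1 ≤ i → i ≤ T → ∀ γ ∈ Θ, Measurable (ζ T i γ)) →
      ∀ γ ∈ S, ∀ i, 1 ≤ i → i ≤ T →
        Integrable (fun ω => |ζ T i γ ω| ^ s) P ∧ ∫ ω, |ζ T i γ ω| ^ s ∂P ≤ κ * D := by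
    intro ζ hB hm γ hγ i h1 h2
    refine integrable_and_integral_le_of_lintegral_le ((hm i h1 h2 γ hγ.1).abs.pow_const s)
      (fun ω => by positivity) (by positivity) ?_
    exact (lintegral_mono fun ω => le_iSup₂ (f := fun γ (_ : γ ∈ S) =>
      ENNReal.ofReal (|ζ T i γ ω| ^ s)) γ hγ).trans (hB i h1 h2)
  have hmε := hmomS ε hBε hεmeas
  have hmξ := hmomS ξ hBξ (hdep.measurable_coeff T)
  -- The Lipschitz bound fails on the null set `N₀`, the row means of the moments are large on `E₁`
  -- and `E₂`, a partial sum is large on `E₃`.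
  set N₀ : Set Ω := {ω | ¬ ∀ i, 1 ≤ i → i ≤ T → ∀ γ ∈ Θ, ∀ γ' ∈ Θ, ‖γ' - γ‖ ≤ h T →
    |ε T i γ' ω - ε T i γ ω| ≤ ξ T i γ ω * ‖γ' - γ‖} with hN₀
  set E₁ : Set Ω := {ω | ∃ g ∈ G, T * (ρ * D) < ∑ i ∈ Finset.Icc 1 T, |ε T i g ω| ^ s} with hE₁
  set E₂ : Set Ω := {ω | ∃ g ∈ G, T * (ρ * D) < ∑ i ∈ Finset.Icc 1 T, |ξ T i g ω| ^ s} with hE₂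
  set w : ℕ := ⌊L * (T * h T)⌋₊ + 1 with hw
  set E₃ : Set Ω := {ω | ∃ g ∈ G, ∃ v ≤ T / w, ∃ l ≤ 3 * w,
    (4 * M₁ + 2) * (D * (Real.log T / a)) < |∑ i ∈ Finset.range l,
      centredClamp P (fun l => ε T l g) T τ (w * v + 1 + i) ω|} with hE₃
  have hlip : ∀ᵐ ω ∂P, ∀ i, 1 ≤ i → i ≤ T → ∀ γ ∈ Θ, ∀ γ' ∈ Θ, ‖γ' - γ‖ ≤ h T →
      |ε T i γ' ω - ε T i γ ω| ≤ ξ T i γ ω * ‖γ' - γ‖ := by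
    rw [ae_all_iff]; intro i
    by_cases hi : 1 ≤ i ∧ i ≤ T
    · filter_upwards [hdep.lipschitz T i hi.1 hi.2] with ω hω _ _ using hω
    · exact Eventually.of_forall fun ω h1 h2 => absurd ⟨h1, h2⟩ hi
  have hPN : P N₀ = 0 := ae_iff.1 hlip
  have hratio : κ * D / (ρ * D) = κ / ρ := mul_div_mul_right _ _ hD0.ne'
  have hPE₁ : P E₁ ≤ ENNReal.ofReal (κ / ρ) := by
    rw [← hratio]
    exact measure_exists_sum_rpow_gt_le (ζ := ε T) hGS hT (mul_pos hρ0 hD0)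
      (fun i h1 h2 g hg => hεmeas i h1 h2 g (hGS g hg).1) hBε
  have hPE₂ : P E₂ ≤ ENNReal.ofReal (κ / ρ) := by
    rw [← hratio]
    exact measure_exists_sum_rpow_gt_le (ζ := ξ T) hGS hT (mul_pos hρ0 hD0)
      (fun i h1 h2 g hg => hdep.measurable_coeff T i h1 h2 g (hGS g hg).1) hBξ
  have hPE₃ : P E₃ ≤ ENNReal.ofReal (tailBound m A β s c L T) := by
    rw [← ofReal_measureReal]
    refine ENNReal.ofReal_le_ofReal ?_
    refine measure_grid_tail_le (X := fun g l => ε T l g) hs hβ2 hc hη hA hT hlog ha ha1 hh hh1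
      hah haT hL hD1 hκ1 hM₁ hN (fun g hg i h1 h2 => hεmeas i h1 h2 g (hGS g hg).1)
      (fun g hg i hi => hmixA g (hGS g hg).1 i hi) fun g hg i h1 h2 => ?_
    obtain ⟨hi, hle⟩ := hmε g (hGS g hg) i h1 h2
    refine le_trans (integral_mono_of_nonneg (Eventually.of_forall fun ω => by positivity) hi
      (Eventually.of_forall fun ω => ?_)) hle
    exact Real.rpow_le_rpow (abs_nonneg _) (abs_clamp_le_abs hτ.le _) (by linarith)
  have hwle : (w : ℝ) ≤ 2 * L * (T * h T) := by
    have h1 := Nat.floor_le (mul_nonneg (by linarith : (0 : ℝ) ≤ L) hTh0.le)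
    have h2 : a ^ 2 ≤ 1 := pow_le_one₀ ha.le ha1
    have h3 : 1 ≤ T * h T := by nlinarith
    have h4 : 1 ≤ L * (T * h T) := one_le_mul_of_one_le_of_one_le hL h3
    rw [hw]; push_cast; linarith
  have hwlt : L * (T * h T) < w := by
    rw [hw]; push_cast; exact Nat.lt_floor_add_one _
  -- Off the exceptional events the deviation is small for all parameters and all points.
  have hgood : ∀ ω, ω ∉ N₀ → ω ∉ E₁ → ω ∉ E₂ → ω ∉ E₃ → ∀ γ ∈ S, ∀ x ∈ Set.Icc (0 : ℝ) 1,
      |kernelAverage K h j ε T x γ ω - ∫ ω', kernelAverage K h j ε T x γ ω' ∂P| ≤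
        (W * (2 + 2 * κ + 2 * ρ) + (W + 6 * L * Lam) * (4 * M₁ + 2)) * (D * a) := by
    intro ω h0 h1 h2 h3 γ hγ x hx
    obtain ⟨g, hg, hγg⟩ := hGnet γ hγ
    have hgS := hGS g hg
    simp only [hN₀, Set.mem_ofPred_eq, not_not] at h0
    simp only [hE₁, hE₂, Set.mem_ofPred_eq, not_exists, not_and, not_lt] at h1 h2
    simp only [hE₃, Set.mem_ofPred_eq, not_exists, not_and, not_lt] at h3
    have hstep : ∀ ω', (∀ i, 1 ≤ i → i ≤ T → ∀ γ ∈ Θ, ∀ γ' ∈ Θ, ‖γ' - γ‖ ≤ h T →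
        |ε T i γ' ω' - ε T i γ ω'| ≤ ξ T i γ ω' * ‖γ' - γ‖) →
        ∀ i, 1 ≤ i → i ≤ T → |ε T i γ ω' - ε T i g ω'| ≤ ξ T i g ω' * (a * h T) :=
      fun ω' hω' i hi1 hi2 => (hω' i hi1 hi2 g hgS.1 γ hγ.1 (hγg.trans hδh)).trans
        (mul_le_mul_of_nonneg_left hγg (hdep.nonneg T i hi1 hi2 g hgS.1 ω'))
    have hsum := abs_kernel_sum_le (Y := fun i => centredClamp P (fun l => ε T l g) T τ i ω)
      hgW hgLip hgs hT hh hx hwlt (by omega)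
      (fun i hi => by simp only [centredClamp]; rw [if_neg (by omega)])
      (fun v hv l hl => h3 g hg v hv l hl)
    have hmain := abs_kernelAverage_sub_integral_le (P := P) (x := x) (ω := ω) (μ := κ * D)
      (R := ρ * D) hT hh hgW (by linarith) hτ (truncLevel_rpow (by linarith) ha hh)
      (fun i hi1 hi2 => integrable_of_integrable_rpow (by linarith) (hεmeas i hi1 hi2 γ hγ.1)
        (hmε γ hγ i hi1 hi2).1)
      (fun i hi1 hi2 => hεmeas i hi1 hi2 g hgS.1)
      (fun i hi1 hi2 => hdep.measurable_coeff T i hi1 hi2 g hgS.1)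
      (hmε g hgS) (hmξ g hgS)
      (by filter_upwards [hlip] with ω' hω' using hstep ω' hω')
      (hstep ω h0) (h1 g hg) (h2 g hg) hsum
    refine hmain.trans ?_
    have e1 : W * (a * h T / h T) * (2 + 2 * (κ * D) + 2 * (ρ * D)) ≤
        W * (2 + 2 * κ + 2 * ρ) * (D * a) := by
      rw [mul_div_cancel_right₀ _ hh.ne']
      calc W * a * (2 + 2 * (κ * D) + 2 * (ρ * D)) ≤
            W * a * (2 * D + 2 * (κ * D) + 2 * (ρ * D)) := by gcongr; linarith
        _ = _ := by ring
    have e2 : ((3 * w : ℕ) : ℝ) * (Lam / (T * h T)) ≤ 6 * L * Lam := by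
      rw [← mul_div_assoc, div_le_iff₀ hTh0]
      push_cast
      calc 3 * (w : ℝ) * Lam ≤ 3 * (2 * L * (T * h T)) * Lam := by gcongr
        _ = _ := by ring
    have e3 : Real.log T / a / (T * h T) = a := by
      rw [← hah]; field_simp
    have e4 : (W + ((3 * w : ℕ) : ℝ) * (Lam / (T * h T))) *
        ((4 * M₁ + 2) * (D * (Real.log T / a))) / (T * h T) ≤
        (W + 6 * L * Lam) * (4 * M₁ + 2) * (D * a) := by
      calc _ = (W + ((3 * w : ℕ) : ℝ) * (Lam / (T * h T))) * (4 * M₁ + 2) *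
            (D * (Real.log T / a / (T * h T))) := by ring
        _ ≤ _ := by rw [e3]; gcongr
    linarith
  have hsub : {ω | ENNReal.ofReal ((W * (2 + 2 * κ + 2 * ρ) + (W + 6 * L * Lam) *
      (4 * M₁ + 2)) * (D * a)) < supDeviation P K h j Θ ε T d ω} ⊆ N₀ ∪ ((E₁ ∪ E₂) ∪ E₃) := by
    intro ω hω
    by_contra hnot
    simp only [Set.mem_union, not_or] at hnot
    obtain ⟨h0, ⟨h1, h2⟩, h3⟩ := hnot
    refine not_le.2 (show _ < supDeviation P K h j Θ ε T d ω from hω) ?_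
    exact iSup₂_le fun γ hγ => iSup₂_le fun x hx =>
      ENNReal.ofReal_le_ofReal (hgood ω h0 h1 h2 h3 γ hγ x hx)
  calc _ ≤ P (N₀ ∪ ((E₁ ∪ E₂) ∪ E₃)) := measure_mono hsub
    _ ≤ P N₀ + (P E₁ + P E₂ + P E₃) := (measure_union_le _ _).trans
        (add_le_add_right ((measure_union_le _ _).trans
          (add_le_add_left (measure_union_le _ _) _)) _)
    _ ≤ 0 + _ := add_le_add hPN.le (add_le_add (add_le_add hPE₁ hPE₂) hPE₃)
    _ = _ := zero_add _

end Deviation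

end KernelAvg

theorem theorem1 {Ω : Type*} [MeasurableSpace Ω] (P : Measure Ω) [IsProbabilityMeasure P]
    (m j : ℕ) (Θ : Set (KernelAvg.Param m)) (ε ξ : KernelAvg.ParamArray m Ω)
    (K : ℝ → ℝ) (h : ℕ → ℝ) (β s lam c : ℝ)
    (hεmeas : ∀ T i : ℕ, 1 ≤ i → i ≤ T → ∀ γ ∈ Θ, Measurable (ε T i γ))
    (hpos : ∀ T : ℕ, 1 ≤ T → 0 < h T)
    (hzero : Tendsto h atTop (𝓝 0))
    (hTh : Tendsto (fun T : ℕ => (T : ℝ) * h T) atTop atTop)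
    (hs : 2 < s) (hlam : 0 ≤ lam) (hc : 0 < c)
    (hmix : KernelAvg.StrongMixing P Θ ε β)
    (hK : KernelAvg.IsKernel K)
    (hdep : KernelAvg.ParamDependence P Θ ε ξ h s lam)
    (hβ : ((m : ℝ) * (s - 1) * (1 + 2 * c) + 2 * s - 1) / (s - 2) < β)
    (hband : Tendsto (fun T : ℕ => Real.log T / ((T : ℝ) ^ KernelAvg.theta m β s c * h T))
      atTop (𝓝 0))
    (hsupε : KernelAvg.UniformMoment P Θ ε (KernelAvg.radius m β s c lam) s lam)
    (hsupξ : KernelAvg.UniformMoment P Θ ξ (KernelAvg.radius m β s c lam) s lam) :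
    KernelAvg.IsBigOp P
      (fun T ω => KernelAvg.supDeviation P K h j Θ ε T (KernelAvg.radius m β s c lam T) ω)
      (fun T => KernelAvg.radius m β s c lam T ^ lam *
        Real.sqrt (Real.log T / ((T : ℝ) * h T))) := by
  open KernelAvg in
  obtain ⟨hβ2, A, hA, hmixA⟩ := hmix
  obtain ⟨W, L, Lam, hW1, hL, hLam, hgW, hgLip, hgs⟩ := hK.exists_bounds j
  obtain ⟨Cε, hCε, hBε⟩ := hsupε
  obtain ⟨Cξ, hCξ, hBξ⟩ := hsupξ
  have hη := lt_mul_sub_two hs hc hβ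
  have hθ := one_sub_theta_pos (m := m) hs hβ2 hc
  set κ : ℝ := 2 * (Cε + Cξ) + 1 with hκ
  have hκ1 : 1 ≤ κ := by rw [hκ]; linarith
  set M₁ : ℝ := 2 * (c * m + m + 3) + 6 * L * (blockConst A β s * κ ^ 2) with hM₁
  have hBC : 0 < blockConst A β s := blockConst_pos hA.le
  have hM₁0 : 0 ≤ M₁ := by positivity
  intro δ hδ
  -- Only `ρ`, the constant in Markov's inequality, depends on the probability `δ`.
  set ρ : ℝ := 4 * κ / δ with hρ
  have hρ0 : 0 < ρ := by positivity
  refine ⟨W * (2 + 2 * κ + 2 * ρ) + (W + 6 * L * Lam) * (4 * M₁ + 2), by positivity, ?_⟩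
  have hnat : Tendsto (fun T : ℕ => (T : ℝ)) atTop atTop := tendsto_natCast_atTop_atTop
  have htail : Tendsto (fun T : ℕ => tailBound m A β s c L T) atTop (𝓝 0) := by
    have h1 := ((tendsto_rpow_neg_atTop one_pos).comp hnat).const_mul
      (56 * L * (2 * (m : ℝ) + 5) ^ m)
    have h2 := ((tendsto_rpow_neg_atTop (neg_pos.2 (rate_exponent_neg (m := m) hs hβ2 hc))).comp
      hnat).const_mul (288 * Real.exp 1 * A * L * ((2 * (m : ℝ) + 5) ^ m * 2 ^ (β + 1)))
    have h3 := h1.add h2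
    simp only [mul_zero, add_zero, neg_neg] at h3
    exact h3
  filter_upwards [eventually_ge_atTop 1, (Real.tendsto_log_atTop.comp hnat).eventually_ge_atTop 1,
    hzero.eventually_le_const one_pos, hband.eventually_le_const one_pos,
    htail.eventually_le_const (half_pos hδ)] with T hT hlog hh1 hbT htT
  simp only [Function.comp_apply] at hlog
  have hT1 : (1 : ℝ) ≤ T := by exact_mod_cast hT
  have hT0 : (0 : ℝ) < T := by linarith
  have hh := hpos T hT
  have hTh0 : 0 < T * h T := mul_pos hT0 hh
  have hlog0 : 0 < Real.log T := by linarith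
  set a : ℝ := Real.sqrt (Real.log T / (T * h T)) with ha_def
  have ha : 0 < a := Real.sqrt_pos.2 (by positivity)
  have ha2 : a ^ 2 = Real.log T / (T * h T) := Real.sq_sqrt (by positivity)
  have hah : a ^ 2 * (T * h T) = Real.log T := by rw [ha2, div_mul_cancel₀ _ hTh0.ne']
  -- The bandwidth condition enters here.
  have haT : a ^ 2 * (T : ℝ) ^ (1 - theta m β s c) ≤ 1 := by
    refine le_of_eq_of_le ?_ hbT
    rw [ha2, Real.rpow_sub hT0, Real.rpow_one]
    have := Real.rpow_pos_of_pos hT0 (theta m β s c)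
    field_simp
  have ha1 : a ≤ 1 := by
    have h1 : 1 ≤ (T : ℝ) ^ (1 - theta m β s c) := Real.one_le_rpow hT1 hθ.le
    have h2 : a ^ 2 ≤ 1 := (le_mul_of_one_le_right (sq_nonneg a) h1).trans haT
    exact (sq_le_one_iff₀ ha.le).1 h2
  set d : ℝ := radius m β s c lam T with hd
  have hd1 : 1 ≤ d := Real.one_le_rpow hT1 (rateExponent_nonneg hs hβ2 hc hlam)
  have hdT : d ≤ (T : ℝ) ^ c := Real.rpow_le_rpow_of_exponent_le hT1 rateExponent_le
  set D : ℝ := d ^ lam with hD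
  have hD1 : 1 ≤ D := Real.one_le_rpow hd1 hlam
  have hD0 : 0 < D := by linarith
  have hB : ∀ C : ℝ, 0 < C → 2 * C ≤ κ →
      ENNReal.ofReal (C * (1 + D)) ≤ ENNReal.ofReal (κ * D) := by
    intro C hC hCκ
    refine ENNReal.ofReal_le_ofReal ?_
    calc C * (1 + D) ≤ 2 * C * D := by nlinarith
      _ ≤ κ * D := mul_le_mul_of_nonneg_right hCκ hD0.le
  refine (measure_supDeviation_gt_le hs hβ2 hc hη hA.le hT hlog ha ha1 hh hh1 hah haT hL hLam hgW
    hgLip hgs hd1 hdT hD1 hκ1 hρ0 le_rfl (hεmeas T) (fun γ hγ => hmixA γ hγ T hT) hdep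
    (fun i h1 h2 => (hBε T i h1 h2).trans (hB Cε hCε (by rw [hκ]; linarith)))
    (fun i h1 h2 => (hBξ T i h1 h2).trans (hB Cξ hCξ (by rw [hκ]; linarith)))).trans ?_
  have hκρ : κ / ρ = δ / 4 := by rw [hρ]; field_simp
  rw [hκρ]
  calc _ ≤ ENNReal.ofReal (δ / 4) + ENNReal.ofReal (δ / 4) + ENNReal.ofReal (δ / 2) :=
        add_le_add_right (ENNReal.ofReal_le_ofReal htT) _
    _ = ENNReal.ofReal δ := by
        rw [← ENNReal.ofReal_add (by positivity) (by positivity),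
          ← ENNReal.ofReal_add (by positivity) (by positivity)]
        congr 1; ring
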